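/- Let $m\ge 2$ and $k\ge 2$ be integers, $\mathcal S^{k-1}=\{x\in\mathbb R^k:\|x\|=1\}$. For $\kappa>0$ and $\theta\in\mathcal S^{k-1}$, the Fisher--von Mises--Langevin (FvML) distribution with concentration $\kappa$ and location $\theta$ is the probability distribution on $\mathcal S^{k-1}$ whose density with respect to the surface area measure is proportional to $x\mapsto\exp(\kappa\,x'\theta)$. Put $$\tilde f_\kappa(t)=\frac{e^{\kappa t}(1-t^2)^{(k-3)/2}}{\int_{-1}^1 e^{\kappa u}(1-u^2)^{(k-3)/2}\,du}\quad(-1\le t\le 1),\qquad A_k(\kappa)=\int_{-1}^1 t\tilde f_\kappa(t)\,dt,\qquad \mathcal J_k(\kappa)=\int_{-1}^1(1-u^2)\tilde f_\kappa(u)\,du .$$ For each $n$, let $n_1,\dots,n_m$ (depending on $n$) be nonnegative integers with $\sum_{i=1}^m n_i=n$, and assume (Assumption A) that for each $i$ the ratio $r_i^{(n)}:=n_i/n$ converges to a constant $r_i>0$ as $n\to\infty$. For $\vartheta=(\kappa_1,\dots,\kappa_m,\theta_1',\dots,\theta_m')'\in\Theta:=(0,\infty)^m\times(\mathcal S^{k-1})^m\subset\mathbb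 R^m\times(\mathbb R^k)^m$, let $\mathrm P^{(n)}_\vartheta$ be the joint distribution of $m$ mutually independent samples $X_{i1},\dots,X_{in_i}$, $i=1,\dots,m$, where the $X_{ij}$, $j=1,\dots,n_i$, are i.i.d. FvML with concentration $\kappa_i$ and location $\theta_i$. Let $$\nu^{(n)}=\mathrm{diag}\big((r_1^{(n)})^{-1/2},\dots,(r_m^{(n)})^{-1/2},(r_1^{(n)})^{-1/2}I_k,\dots,(r_m^{(n)})^{-1/2}I_k\big).$$ Define the central sequence $\Delta^{(n)}_\vartheta\in\mathbb R^m\times(\mathbb R^k)^m$ as the vector with components $$\Delta^{(\mathrm I,i)(n)}_\vartheta=n_i^{-1/2}\sum_{j=1}^{n_i}\big(X_{ij}'\theta_i-A_k(\kappa_i)\big)\in\mathbb R,\qquad \Delta^{(\mathrm{II},i)(n)}_\vartheta=\kappa_i n_i^{-1/2}\sum_{j=1}^{n_i}\big(1-(X_{ij}'\theta_i)^2\big)^{1/2}S_{\theta_i}(X_{ij})\in\mathbb R^k,$$ $i=1,\dots,m$ (first all the $\Delta^{(\mathrm I,i)(n)}_\vartheta$, then all the $\Delta^{(\mathrm{II},i)(n)}_\vartheta$),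 where $S_\theta(x)=(x-(x'\theta)\theta)/\|x-(x'\theta)\theta\|$, and the block-diagonal Fisher information $$\Gamma_\vartheta=\mathrm{diag}\big(\Gamma^{(\mathrm I,1)}_\vartheta,\dots,\Gamma^{(\mathrm I,m)}_\vartheta,\Gamma^{(\mathrm{II},1)}_\vartheta,\dots,\Gamma^{(\mathrm{II},m)}_\vartheta\big),$$ $$\Gamma^{(\mathrm I,i)}_\vartheta=1-\frac{k-1}{\kappa_i}A_k(\kappa_i)-A_k(\kappa_i)^2,\qquad \Gamma^{(\mathrm{II},i)}_\vartheta=\frac{\kappa_i^2\mathcal J_k(\kappa_i)}{k-1}\,(I_k-\theta_i\theta_i').$$ **Proposition.** The family $\{\mathrm P^{(n)}_\vartheta:\vartheta\in\Theta\}$ is uniformly locally asymptotically normal (ULAN): for any $\vartheta\in\Theta$, any sequence $\vartheta^{(n)}\in\Theta$ with $\vartheta^{(n)}-\vartheta=O(n^{-1/2})$ and any bounded sequence $\tau^{(n)}\in\mathbb R^m\times(\mathbb R^k)^m$ such that $\vartheta^{(n)}+n^{-1/2}\nu^{(n)}\tau^{(n)}\in\Theta$ for all $n$, $$\log\frac{d\mathrm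 P^{(n)}_{\vartheta^{(n)}+n^{-1/2}\nu^{(n)}\tau^{(n)}}}{d\mathrm P^{(n)}_{\vartheta^{(n)}}}=(\tau^{(n)})'\Delta^{(n)}_{\vartheta^{(n)}}-\frac12(\tau^{(n)})'\,\Gamma_\vartheta\,\tau^{(n)}+o_{\mathrm P}(1),$$ and $\Gamma_\vartheta$ is positive semidefinite with $$\Delta^{(n)}_{\vartheta^{(n)}}\ \xrightarrow{\ \mathcal D\ }\ \mathcal N_{m(k+1)}(0,\Gamma_\vartheta),$$ both under $\mathrm P^{(n)}_{\vartheta^{(n)}}$ as $n\to\infty$. -/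

import Mathlib

open MeasureTheory ProbabilityTheory Filter Topology Asymptotics Matrix

namespace FvML

noncomputable section

/-- The unit sphere `S^{k-1}` of `ℝ^k`. -/
abbrev Sphere (k : ℕ) : Type := Metric.sphere (0 : EuclideanSpace ℝ (Fin k)) 1

/-- The usual surface area measure on `S^{k-1}`. -/
def surfaceMeasure (k : ℕ) : Measure (Sphere k) :=
  (volume : Measure (EuclideanSpace ℝ (Fin k))).toSphere

/-- The Fisher-von Mises-Langevin distribution on `S^{k-1}` with concentration `κ` and location
`θ`: its density with respect to the surface area measure is `x ↦ c * exp (κ * ⟪x, θ⟫)`, where the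
normalizing constant is `c = (∫ x, exp (κ * ⟪x, θ⟫))⁻¹`. -/
def fvml (k : ℕ) (κ : ℝ) (θ : EuclideanSpace ℝ (Fin k)) : Measure (Sphere k) :=
  (surfaceMeasure k).tilted
    (fun x => κ * inner ℝ (x : EuclideanSpace ℝ (Fin k)) θ)

instance isProbabilityMeasure_fvml (k : ℕ) [k.AtLeastTwo] (κ : ℝ) (θ : EuclideanSpace ℝ (Fin k)) :
    IsProbabilityMeasure (fvml k κ θ) := by
  have : Nonempty (Fin k) := ⟨⟨0, by have := Nat.AtLeastTwo.prop (n := k); omega⟩⟩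
  have : IsFiniteMeasure (surfaceMeasure k) := by unfold surfaceMeasure; infer_instance
  have : NeZero (surfaceMeasure k) := by
    refine ⟨?_⟩
    unfold surfaceMeasure
    simp
  refine isProbabilityMeasure_tilted ?_
  have hc : Continuous (fun x : Sphere k =>
      Real.exp (κ * inner ℝ (x : EuclideanSpace ℝ (Fin k)) θ)) := by fun_prop
  exact hc.integrable_of_hasCompactSupport (HasCompactSupport.of_compactSpace _)

/-- The unnormalized density `exp (κ t) (1 - t²)^{(k-3)/2}` on `[-1, 1]` of the projection of an
FvML vector on its location. -/
def projWeight (k : ℕ) (κ t : ℝ) : ℝ :=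
  Real.exp (κ * t) * (1 - t ^ 2) ^ (((k : ℝ) - 3) / 2)

/-- The density on `[-1, 1]` of the projection of an FvML vector on its location. -/
def projDensity (k : ℕ) (κ t : ℝ) : ℝ :=
  projWeight k κ t / ∫ u in (-1 : ℝ)..1, projWeight k κ u

/-- The function `A_k`. -/
def meanA (k : ℕ) (κ : ℝ) : ℝ :=
  (∫ t in (-1 : ℝ)..1, t * projWeight k κ t) / ∫ t in (-1 : ℝ)..1, projWeight k κ t

/-- The function `J_k`. -/
def fisherJ (k : ℕ) (κ : ℝ) : ℝ :=
  ∫ u in (-1 : ℝ)..1, (1 - u ^ 2) * projDensity k κ u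

/-- The coordinates of `ℝ^m × (ℝ^k)^m`: `Sum.inl i` is the `i`-th concentration coordinate and
`Sum.inr (a, i)` is the `a`-th coordinate of the `i`-th location. -/
abbrev Idx (m k : ℕ) : Type := Fin m ⊕ (Fin k × Fin m)

/-- The space `ℝ^m × (ℝ^k)^m ≅ ℝ^{m(k+1)}` with its Euclidean norm. -/
abbrev Vec (m k : ℕ) : Type := EuclideanSpace ℝ (Idx m k)

/-- The `i`-th concentration of `v = (κ₁, …, κ_m, θ₁, …, θ_m)`. -/
def conc {m k : ℕ} (v : Vec m k) (i : Fin m) : ℝ := v (Sum.inl i)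

/-- The `i`-th location of `v = (κ₁, …, κ_m, θ₁, …, θ_m)`. -/
def loc {m k : ℕ} (v : Vec m k) (i : Fin m) : EuclideanSpace ℝ (Fin k) :=
  WithLp.toLp 2 (fun a => v (Sum.inr (a, i)))

/-- The parameter set `(0, ∞)^m × (S^{k-1})^m`. -/
def paramSet (m k : ℕ) : Set (Vec m k) :=
  {v | ∀ i, 0 < conc v i ∧ ‖loc v i‖ = 1}

/-- Data sets made of `m` samples of points of `S^{k-1}`, the `i`-th one of size `N i`. -/
abbrev Sample (m k : ℕ) (N : Fin m → ℕ) : Type := (i : Fin m) → Fin (N i) → Sphere k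

/-- The joint distribution of `m` mutually independent samples, the `i`-th one consisting of `N i`
i.i.d. FvML points with concentration `conc v i` and location `loc v i`. -/
def sampleLaw {m k : ℕ} (N : Fin m → ℕ) (v : Vec m k) : Measure (Sample m k N) :=
  Measure.pi fun i => Measure.pi fun _ : Fin (N i) => fvml k (conc v i) (loc v i)

instance isProbabilityMeasure_sampleLaw {m k : ℕ} [k.AtLeastTwo] (N : Fin m → ℕ) (v : Vec m k) :
    IsProbabilityMeasure (sampleLaw N v) := by
  unfold sampleLaw
  infer_instance

/-- The residual `x - ⟪x, θ⟫ θ`. -/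
def residual {k : ℕ} (θ x : EuclideanSpace ℝ (Fin k)) : EuclideanSpace ℝ (Fin k) :=
  x - inner ℝ x θ • θ

/-- The spatial sign `S_θ(x) = (x - ⟪x, θ⟫ θ) / ‖x - ⟪x, θ⟫ θ‖` of the residual (set to `0` on the
null set where the residual vanishes). -/
def signS {k : ℕ} (θ x : EuclideanSpace ℝ (Fin k)) : EuclideanSpace ℝ (Fin k) :=
  ‖residual θ x‖⁻¹ • residual θ x

/-- The concentration part of the one-sample central sequence, for a sample of size `n`. -/
def centralI {k n : ℕ} (κ : ℝ) (θ : EuclideanSpace ℝ (Fin k)) (x : Fin n → Sphere k) : ℝ :=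
  (n : ℝ) ^ (-1 / 2 : ℝ) *
    ∑ j, (inner ℝ (x j : EuclideanSpace ℝ (Fin k)) θ - meanA k κ)

/-- The location part of the one-sample central sequence, for a sample of size `n`. -/
def centralII {k n : ℕ} (κ : ℝ) (θ : EuclideanSpace ℝ (Fin k)) (x : Fin n → Sphere k) :
    EuclideanSpace ℝ (Fin k) :=
  (κ * (n : ℝ) ^ (-1 / 2 : ℝ)) •
    ∑ j, (1 - (inner ℝ (x j : EuclideanSpace ℝ (Fin k)) θ) ^ 2) ^ (1 / 2 : ℝ) •
      signS θ (x j : EuclideanSpace ℝ (Fin k))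

/-- The `m`-sample central sequence. -/
def central {m k : ℕ} {N : Fin m → ℕ} (v : Vec m k) (x : Sample m k N) : Vec m k :=
  WithLp.toLp 2 (Sum.elim
    (fun i => centralI (conc v i) (loc v i) (x i))
    (fun p => centralII (conc v p.2) (loc v p.2) (x p.2) p.1))

/-- The one-sample Fisher information for the concentration. -/
def fisherI (k : ℕ) (κ : ℝ) : ℝ :=
  1 - ((k : ℝ) - 1) / κ * meanA k κ - meanA k κ ^ 2

/-- The one-sample Fisher information for the location. -/
def fisherII {k : ℕ} (κ : ℝ) (θ : EuclideanSpace ℝ (Fin k)) : Matrix (Fin k) (Fin k) ℝ :=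
  (κ ^ 2 * fisherJ k κ / ((k : ℝ) - 1)) • (1 - vecMulVec θ θ)

/-- The `m`-sample Fisher information, a block-diagonal matrix. -/
def fisher {m k : ℕ} (v : Vec m k) : Matrix (Idx m k) (Idx m k) ℝ :=
  fromBlocks
    (diagonal fun i => fisherI k (conc v i)) 0
    0 (blockDiagonal fun i => fisherII (conc v i) (loc v i))

/-- The matrix `diag(r₁^{-1/2}, …, r_m^{-1/2}, r₁^{-1/2} I_k, …, r_m^{-1/2} I_k)` with
`r_i = N_i / n`. -/
def scaleMatrix {m : ℕ} (k n : ℕ) (N : Fin m → ℕ) : Matrix (Idx m k) (Idx m k) ℝ :=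
  fromBlocks
    (diagonal fun i => ((N i : ℝ) / n) ^ (-1 / 2 : ℝ)) 0
    0 (blockDiagonal fun i => ((N i : ℝ) / n) ^ (-1 / 2 : ℝ) • (1 : Matrix (Fin k) (Fin k) ℝ))

/-- The locally perturbed parameter `v + n^{-1/2} ν τ`, where `ν` is the scaling matrix. -/
def perturb {m k : ℕ} (n : ℕ) (N : Fin m → ℕ) (v τ : Vec m k) : Vec m k :=
  v + (n : ℝ) ^ (-1 / 2 : ℝ) • (WithLp.toLp 2 (scaleMatrix k n N *ᵥ τ) : Vec m k)

/-- `R n = o_P(1)` under `P n`: convergence to zero in probability, along probability spaces that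
may vary with `n`. -/
def IsLittleOP {Ω : ℕ → Type*} [∀ n, MeasurableSpace (Ω n)] (P : ∀ n, Measure (Ω n))
    (R : ∀ n, Ω n → ℝ) : Prop :=
  ∀ ε : ℝ, 0 < ε → Tendsto (fun n => P n {x | ε ≤ |R n x|}) atTop (𝓝 0)

end

end FvML

namespace FvML

noncomputable section

/-! The FvML laws form an exponential family with natural parameter `κ • θ`, so the likelihood ratio
is explicit (`llr_sampleLaw`): for sample `i` its logarithm is a sum of terms `⟪x, κ'θ' - κθ⟫` minus
`N i` times an increment of the log-partition function. By rotation invariance that function depends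
on `κ` alone. Write `a` for the rate `(N i)^(-1/2)` and put `κ' = κ + a s`, `θ' = θ + a u`. The
constraint `‖θ'‖ = 1` forces `⟪θ, u⟫ = -a‖u‖²/2`, and the exponent then splits exactly into `a`
times the score, `a²` times a linear function of `x`, and a constant
(`log_likelihood_remainder_eq`). The scores add up to `τ'Δ`. The `a²` terms form an empirical mean,
replaced by its expectation through Chebyshev's inequality. What is left is deterministic and
converges by a second order Taylor expansion of the log-partition function, whose first two
derivatives are `meanA` and `fisherI`; the expansion is uniform in the base point because the base
point moves with `n` (`tendsto_remainder`). The score is centered with second moment `fisherForm`,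
the quadratic form of the information; hence the information is positive semidefinite. Asymptotic
normality follows from convergence of characteristic functions: they factor over independent
observations, and `norm_charFun_pow_sub_le` has an explicit error for bounded summands, so it
tolerates moving laws. Since `meanA` and `fisherJ` are one-dimensional integrals, the law of the
projection on `θ` is needed (`integral_sphere_inner`). The sphere and the weight `(1 -
t²)^((k-3)/2)` satisfy the same integration by parts formula, so their moments agree up to a factor,
and Weierstrass approximation does the rest. -/

/-! ### Symmetry and integration by parts on the sphere -/

/-- A linear isometry of `ℝ^k` acts on the unit sphere. -/
def sphereMap {k : ℕ} (L : EuclideanSpace ℝ (Fin k) ≃ₗᵢ[ℝ] EuclideanSpace ℝ (Fin k)) :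
    Sphere k ≃ₜ Sphere k where
  toFun x := ⟨L x, by simp⟩
  invFun x := ⟨L.symm x, by simp⟩
  left_inv x := by ext; simp
  right_inv x := by ext; simp
  continuous_toFun := by fun_prop
  continuous_invFun := by fun_prop

-- `Measure.toSphere` measures a set through the volume of the cone over it; a linear isometry
-- carries cones to cones and preserves volume.
open scoped Pointwise in
theorem measurePreserving_sphereMap {k : ℕ}
    (L : EuclideanSpace ℝ (Fin k) ≃ₗᵢ[ℝ] EuclideanSpace ℝ (Fin k)) :
    MeasurePreserving (sphereMap L) (surfaceMeasure k) (surfaceMeasure k) := by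
  refine ⟨(sphereMap L).continuous.measurable, ?_⟩
  ext s hs
  rw [Measure.map_apply (sphereMap L).continuous.measurable hs, surfaceMeasure,
    Measure.toSphere_apply' _ hs,
    Measure.toSphere_apply' _ ((sphereMap L).continuous.measurable hs)]
  congr 1
  have hset : Set.Ioo (0 : ℝ) 1 • ((↑) '' (sphereMap L ⁻¹' s) : Set (EuclideanSpace ℝ (Fin k)))
      = L ⁻¹' (Set.Ioo (0 : ℝ) 1 • ((↑) '' s : Set (EuclideanSpace ℝ (Fin k)))) := by
    ext z
    simp only [Set.mem_smul, Set.mem_image, Set.mem_preimage]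
    constructor
    · rintro ⟨r, hr, _, ⟨x, hx, rfl⟩, rfl⟩
      exact ⟨r, hr, _, ⟨_, hx, rfl⟩, by simp [sphereMap]⟩
    · rintro ⟨r, hr, _, ⟨x, hx, rfl⟩, h⟩
      refine ⟨r, hr, _, ⟨(sphereMap L).symm x, by simpa using hx, rfl⟩, ?_⟩
      apply L.injective
      rw [← h]
      simp [sphereMap]
  rw [hset]
  exact L.measurePreserving.measure_preimage_equiv (f := L.toHomeomorph.toMeasurableEquiv) _

theorem integral_sphere_comp_isometry {k : ℕ} {F : Type*} [NormedAddCommGroup F] [NormedSpace ℝ F]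
    (L : EuclideanSpace ℝ (Fin k) ≃ₗᵢ[ℝ] EuclideanSpace ℝ (Fin k))
    (G : EuclideanSpace ℝ (Fin k) → F) :
    ∫ x : Sphere k, G (L x) ∂surfaceMeasure k = ∫ x : Sphere k, G x ∂surfaceMeasure k :=
  (measurePreserving_sphereMap L).integral_comp (sphereMap L).measurableEmbedding
    (fun x : Sphere k => G x)

instance isFiniteMeasure_surfaceMeasure (k : ℕ) : IsFiniteMeasure (surfaceMeasure k) := by
  unfold surfaceMeasure; infer_instance

theorem integrable_of_continuous {k : ℕ} {F : Type*} [NormedAddCommGroup F]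
    {μ : Measure (Sphere k)} [IsFiniteMeasure μ] {g : Sphere k → F} (hg : Continuous g) :
    Integrable g μ :=
  hg.integrable_of_hasCompactSupport (HasCompactSupport.of_compactSpace _)

/-- The change of variables is the reflection in the line at angle `α / 2` in the plane of `θ` and
`e`. It acts as `-1` orthogonally to that plane, which is harmless because the integrand sees only
the two plane coordinates. -/
theorem integral_sphere_rotation {k : ℕ} {θ e : EuclideanSpace ℝ (Fin k)} (hθ : ‖θ‖ = 1)
    (he : ‖e‖ = 1) (hθe : inner ℝ θ e = 0) (G : ℝ → ℝ → ℝ) (α : ℝ) :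
    ∫ x : Sphere k, G (inner ℝ (x : EuclideanSpace ℝ (Fin k)) θ * Real.cos α
          + inner ℝ (x : EuclideanSpace ℝ (Fin k)) e * Real.sin α)
        (inner ℝ (x : EuclideanSpace ℝ (Fin k)) θ * Real.sin α
          - inner ℝ (x : EuclideanSpace ℝ (Fin k)) e * Real.cos α) ∂surfaceMeasure k
      = ∫ x : Sphere k, G (inner ℝ (x : EuclideanSpace ℝ (Fin k)) θ)
          (inner ℝ (x : EuclideanSpace ℝ (Fin k)) e) ∂surfaceMeasure k := by
  set u : EuclideanSpace ℝ (Fin k) := Real.cos (α / 2) • θ + Real.sin (α / 2) • e with hu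
  have hθθ : inner ℝ θ θ = 1 := by rw [real_inner_self_eq_norm_sq, hθ]; norm_num
  have hee : inner ℝ e e = 1 := by rw [real_inner_self_eq_norm_sq, he]; norm_num
  have heθ : inner ℝ e θ = 0 := by rw [real_inner_comm]; exact hθe
  have huθ : inner ℝ u θ = Real.cos (α / 2) := by
    simp only [hu, inner_add_left, real_inner_smul_left, hθθ, heθ]; ring
  have hue : inner ℝ u e = Real.sin (α / 2) := by
    simp only [hu, inner_add_left, real_inner_smul_left, hθe, hee]; ring
  have hun : ‖u‖ = 1 := by
    have : ‖u‖ ^ 2 = 1 := by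
      rw [← real_inner_self_eq_norm_sq]
      conv_lhs => rw [hu]
      simp only [inner_add_left, real_inner_smul_left]
      rw [real_inner_comm, huθ, real_inner_comm, hue]
      nlinarith [Real.sin_sq_add_cos_sq (α / 2)]
    nlinarith [norm_nonneg u]
  have hc : Real.cos α = 2 * Real.cos (α / 2) ^ 2 - 1 := by
    rw [← Real.cos_two_mul]; congr 1; ring
  have hs : Real.sin α = 2 * Real.sin (α / 2) * Real.cos (α / 2) := by
    rw [← Real.sin_two_mul]; congr 1; ring
  rw [← integral_sphere_comp_isometry (ℝ ∙ u).reflection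
    (fun x => G (inner ℝ x θ) (inner ℝ x e))]
  congr 1
  ext x
  have hxu : inner ℝ u (x : EuclideanSpace ℝ (Fin k)) = Real.cos (α / 2) *
      inner ℝ (x : EuclideanSpace ℝ (Fin k)) θ + Real.sin (α / 2) *
      inner ℝ (x : EuclideanSpace ℝ (Fin k)) e := by
    rw [hu, inner_add_left, real_inner_smul_left, real_inner_smul_left, real_inner_comm θ,
      real_inner_comm e]
  have hr := Submodule.reflection_singleton_apply (𝕜 := ℝ) u (x : EuclideanSpace ℝ (Fin k))
  rw [hr]
  simp only [hun, inner_sub_left, two_smul, inner_add_left, real_inner_smul_left, huθ, hue,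
    hxu, hc, hs, RCLike.ofReal_real_eq_id, id]
  have h2 : Real.sin (α / 2) ^ 2 = 1 - Real.cos (α / 2) ^ 2 := by
    rw [← Real.sin_sq_add_cos_sq (α / 2)]; ring
  congr 1
  · ring
  · linear_combination (-2 * inner ℝ (x : EuclideanSpace ℝ (Fin k)) e) * h2

/-- The reflection in the line of `θ` keeps the coordinate along `θ` and changes the sign of the one
along `e`. -/
theorem integral_sphere_odd {k : ℕ} {θ e : EuclideanSpace ℝ (Fin k)} (hθ : ‖θ‖ = 1)
    (hθe : inner ℝ θ e = 0) (g : ℝ → ℝ) :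
    ∫ x : Sphere k, g (inner ℝ (x : EuclideanSpace ℝ (Fin k)) θ) *
      inner ℝ (x : EuclideanSpace ℝ (Fin k)) e ∂surfaceMeasure k = 0 := by
  have hr (x : EuclideanSpace ℝ (Fin k)) :
      (ℝ ∙ θ).reflection x = (2 * inner ℝ x θ) • θ - x := by
    rw [Submodule.reflection_singleton_apply, hθ, real_inner_comm]
    simp [two_smul, two_mul, add_smul]
  have hθθ : inner ℝ θ θ = 1 := by rw [real_inner_self_eq_norm_sq, hθ]; norm_num
  have h := integral_sphere_comp_isometry (ℝ ∙ θ).reflection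
    (fun x => g (inner ℝ x θ) * inner ℝ x e)
  simp only [hr, inner_sub_left, real_inner_smul_left, hθθ, hθe] at h
  have h2 : ∀ x : Sphere k, g (2 * inner ℝ (x : EuclideanSpace ℝ (Fin k)) θ * 1
      - inner ℝ (x : EuclideanSpace ℝ (Fin k)) θ)
      * (2 * inner ℝ (x : EuclideanSpace ℝ (Fin k)) θ * 0
      - inner ℝ (x : EuclideanSpace ℝ (Fin k)) e) = -(g (inner ℝ (x : EuclideanSpace ℝ (Fin k)) θ) *
      inner ℝ (x : EuclideanSpace ℝ (Fin k)) e) := by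
    intro x; ring_nf
  simp only [h2, integral_neg] at h
  linarith

/-- Infinitesimal rotation invariance: with `G a b = f a * b`, the integral of
`integral_sphere_rotation` is constant in `α`, and its derivative at `α = 0` is the difference of
the two sides. -/
theorem integral_sphere_deriv_mul_sq {k : ℕ} {θ e : EuclideanSpace ℝ (Fin k)} (hθ : ‖θ‖ = 1)
    (he : ‖e‖ = 1) (hθe : inner ℝ θ e = 0) {f f' : ℝ → ℝ} (hf : ∀ t, HasDerivAt f (f' t) t)
    (hf' : Continuous f') :
    ∫ x : Sphere k, f' (inner ℝ (x : EuclideanSpace ℝ (Fin k)) θ) *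
        inner ℝ (x : EuclideanSpace ℝ (Fin k)) e ^ 2 ∂surfaceMeasure k
      = ∫ x : Sphere k, f (inner ℝ (x : EuclideanSpace ℝ (Fin k)) θ) *
        inner ℝ (x : EuclideanSpace ℝ (Fin k)) θ ∂surfaceMeasure k := by
  have hfc : Continuous f := continuous_iff_continuousAt.2 fun t => (hf t).continuousAt
  let T : Sphere k → ℝ := fun x => inner ℝ (x : EuclideanSpace ℝ (Fin k)) θ
  let Y : Sphere k → ℝ := fun x => inner ℝ (x : EuclideanSpace ℝ (Fin k)) e
  have hT : Continuous T := by fun_prop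
  have hY : Continuous Y := by fun_prop
  let D : ℝ → Sphere k → ℝ := fun α x =>
    f' (T x * Real.cos α + Y x * Real.sin α) * (-T x * Real.sin α + Y x * Real.cos α)
      * (T x * Real.sin α - Y x * Real.cos α)
    + f (T x * Real.cos α + Y x * Real.sin α) * (T x * Real.cos α + Y x * Real.sin α)
  have hDc : Continuous (fun p : ℝ × Sphere k => D p.1 p.2) := by fun_prop
  obtain ⟨C, hC⟩ := (isCompact_Icc (a := (-1 : ℝ)) (b := 1)).prod
    (isCompact_univ (X := Sphere k)) |>.exists_bound_of_continuousOn hDc.continuousOn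
  have key := hasDerivAt_integral_of_dominated_loc_of_deriv_le (μ := surfaceMeasure k)
    (x₀ := (0 : ℝ)) (s := Set.Icc (-1 : ℝ) 1) (bound := fun _ => C)
    (F := fun α x => f (T x * Real.cos α + Y x * Real.sin α) *
      (T x * Real.sin α - Y x * Real.cos α)) (F' := D)
    (Icc_mem_nhds (by norm_num) (by norm_num))
    (Eventually.of_forall fun α => (by fun_prop : Continuous _).aestronglyMeasurable)
    (integrable_of_continuous (by fun_prop))
    (by exact (by fun_prop : Continuous (D 0)).aestronglyMeasurable)
    (Eventually.of_forall fun x α hα => hC (α, x) ⟨hα, Set.mem_univ _⟩)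
    (integrable_const _)
    (Eventually.of_forall fun x α _ => by
      have h1 : HasDerivAt (fun α => T x * Real.cos α + Y x * Real.sin α)
          (-T x * Real.sin α + Y x * Real.cos α) α := by
        have := ((Real.hasDerivAt_cos α).const_mul (T x)).add
          ((Real.hasDerivAt_sin α).const_mul (Y x))
        exact this.congr_deriv (by ring)
      have h2 : HasDerivAt (fun α => T x * Real.sin α - Y x * Real.cos α)
          (T x * Real.cos α + Y x * Real.sin α) α := by
        have := ((Real.hasDerivAt_sin α).const_mul (T x)).sub
          ((Real.hasDerivAt_cos α).const_mul (Y x))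
        exact this.congr_deriv (by ring)
      exact ((hf _).comp α h1).mul h2)
  have hconst : (fun α => ∫ x, f (T x * Real.cos α + Y x * Real.sin α) *
      (T x * Real.sin α - Y x * Real.cos α) ∂surfaceMeasure k)
      = fun _ => ∫ x, f (T x) * Y x ∂surfaceMeasure k := by
    ext α
    exact integral_sphere_rotation hθ he hθe (fun a b => f a * b) α
  have h0 := key.2
  rw [hconst] at h0
  have h1 := h0.unique (hasDerivAt_const _ _)
  have h2 : ∀ x, D 0 x = f (T x) * T x - f' (T x) * Y x ^ 2 := by
    intro x; simp only [D, Real.cos_zero, Real.sin_zero]; ring_nf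
  simp only [h2] at h1
  rw [integral_sub (integrable_of_continuous (by fun_prop))
    (integrable_of_continuous (by fun_prop))] at h1
  simp only [T, Y] at h1
  linarith

/-- Sum `integral_sphere_deriv_mul_sq` over an orthonormal basis of the `k - 1` dimensional
complement of `θ`; the squared coordinates add up to `1 - ⟪x, θ⟫²`. -/
theorem integral_sphere_deriv_mul {k : ℕ} [k.AtLeastTwo] {θ : EuclideanSpace ℝ (Fin k)}
    (hθ : ‖θ‖ = 1) {f f' : ℝ → ℝ} (hf : ∀ t, HasDerivAt f (f' t) t) (hf' : Continuous f') :
    ∫ x : Sphere k, f' (inner ℝ (x : EuclideanSpace ℝ (Fin k)) θ) *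
        (1 - inner ℝ (x : EuclideanSpace ℝ (Fin k)) θ ^ 2) ∂surfaceMeasure k
      = (k - 1) * ∫ x : Sphere k, f (inner ℝ (x : EuclideanSpace ℝ (Fin k)) θ) *
        inner ℝ (x : EuclideanSpace ℝ (Fin k)) θ ∂surfaceMeasure k := by
  have hk : 2 ≤ k := Nat.AtLeastTwo.prop
  have hθ0 : θ ≠ 0 := by rintro rfl; simp at hθ
  have : Fact (Module.finrank ℝ (EuclideanSpace ℝ (Fin k)) = (k - 1) + 1) :=
    ⟨by simp; omega⟩
  have hd : Module.finrank ℝ (ℝ ∙ θ)ᗮ = k - 1 := Submodule.finrank_orthogonal_span_singleton hθ0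
  let b := stdOrthonormalBasis ℝ (ℝ ∙ θ)ᗮ
  have hθb : ∀ i, inner ℝ θ (b i : EuclideanSpace ℝ (Fin k)) = 0 := fun i =>
    Submodule.mem_orthogonal_singleton_iff_inner_right.1 (b i).2
  have hsum : ∀ x : Sphere k, ∑ i, inner ℝ (x : EuclideanSpace ℝ (Fin k))
      (b i : EuclideanSpace ℝ (Fin k)) ^ 2
      = 1 - inner ℝ (x : EuclideanSpace ℝ (Fin k)) θ ^ 2 := by
    intro x
    have hxn : ‖(x : EuclideanSpace ℝ (Fin k))‖ = 1 := by simp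
    have hxx : inner ℝ (x : EuclideanSpace ℝ (Fin k)) (x : EuclideanSpace ℝ (Fin k)) = 1 := by
      rw [real_inner_self_eq_norm_sq, hxn]; norm_num
    have hθθ : inner ℝ θ θ = 1 := by rw [real_inner_self_eq_norm_sq, hθ]; norm_num
    set y : EuclideanSpace ℝ (Fin k) := x - inner ℝ (x : EuclideanSpace ℝ (Fin k)) θ • θ with hy
    have hym : y ∈ (ℝ ∙ θ)ᗮ := by
      rw [Submodule.mem_orthogonal_singleton_iff_inner_right, hy, inner_sub_right,
        real_inner_smul_right, hθθ, real_inner_comm]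
      ring
    have h1 := b.sum_sq_norm_inner_left ⟨y, hym⟩
    have h2 : ‖(⟨y, hym⟩ : (ℝ ∙ θ)ᗮ)‖ ^ 2
        = 1 - inner ℝ (x : EuclideanSpace ℝ (Fin k)) θ ^ 2 := by
      rw [Submodule.coe_norm, ← real_inner_self_eq_norm_sq]
      simp only [hy, inner_sub_left, inner_sub_right, real_inner_smul_left, real_inner_smul_right,
        hxx, hθθ, real_inner_comm θ]
      rw [real_inner_comm]
      ring
    rw [← h2, ← h1]
    refine Finset.sum_congr rfl fun i _ => ?_
    rw [Submodule.coe_inner, Real.norm_eq_abs, sq_abs]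
    congr 1
    simp [hy, inner_sub_left, real_inner_smul_left, hθb]
  simp only [← hsum, Finset.mul_sum]
  rw [integral_finsetSum _ fun i _ => integrable_of_continuous (by fun_prop)]
  have : ∀ i, ∫ x : Sphere k, f' (inner ℝ (x : EuclideanSpace ℝ (Fin k)) θ) *
      inner ℝ (x : EuclideanSpace ℝ (Fin k)) (b i : EuclideanSpace ℝ (Fin k)) ^ 2
        ∂surfaceMeasure k = ∫ x : Sphere k, f (inner ℝ (x : EuclideanSpace ℝ (Fin k)) θ) *
        inner ℝ (x : EuclideanSpace ℝ (Fin k)) θ ∂surfaceMeasure k := fun i =>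
    integral_sphere_deriv_mul_sq hθ (b.orthonormal.1 i) (hθb i) hf hf'
  simp only [this, Finset.sum_const, Finset.card_univ, Fintype.card_fin, hd, nsmul_eq_mul]
  rw [Nat.cast_sub (by omega)]
  simp

/-! ### The weight on `[-1, 1]` and the law of a projection -/

/-- The density `(1 - t²)^{(k-3)/2}` of a coordinate of a uniform point of the sphere, up to a
constant. -/
def sphereWeight (k : ℕ) (t : ℝ) : ℝ := (1 - t ^ 2) ^ (((k : ℝ) - 3) / 2)

theorem projWeight_eq (k : ℕ) (κ t : ℝ) :
    projWeight k κ t = Real.exp (κ * t) * sphereWeight k t := rfl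

theorem one_sub_sq_nonneg {t : ℝ} (ht : t ∈ Set.Icc (-1 : ℝ) 1) : 0 ≤ 1 - t ^ 2 := by
  nlinarith [ht.1, ht.2]

theorem one_sub_sq_pos {t : ℝ} (ht : t ∈ Set.Ioo (-1 : ℝ) 1) : 0 < 1 - t ^ 2 := by
  nlinarith [ht.1, ht.2]

theorem sphereWeight_nonneg (k : ℕ) {t : ℝ} (ht : t ∈ Set.Icc (-1 : ℝ) 1) :
    0 ≤ sphereWeight k t := Real.rpow_nonneg (one_sub_sq_nonneg ht) _

theorem sphereWeight_mul_one_sub_sq (k : ℕ) [k.AtLeastTwo] {t : ℝ}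
    (ht : t ∈ Set.Icc (-1 : ℝ) 1) :
    sphereWeight k t * (1 - t ^ 2) = (1 - t ^ 2) ^ (((k : ℝ) - 1) / 2) := by
  have hk : (2 : ℝ) ≤ k := by exact_mod_cast Nat.AtLeastTwo.prop (n := k)
  rcases (one_sub_sq_nonneg ht).eq_or_lt with h | h
  -- At the endpoints both sides vanish whatever value the weight takes there, since the exponent
  -- `(k - 1) / 2` is positive.
  · rw [← h, mul_zero, Real.zero_rpow (by linarith)]
  · rw [sphereWeight, ← Real.rpow_add_one h.ne']
    congr 1
    ring

theorem continuous_one_sub_sq_rpow (k : ℕ) [k.AtLeastTwo] :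
    Continuous fun t : ℝ => (1 - t ^ 2) ^ (((k : ℝ) - 1) / 2) := by
  have hk : (2 : ℝ) ≤ k := by exact_mod_cast Nat.AtLeastTwo.prop (n := k)
  exact (by fun_prop : Continuous fun t : ℝ => 1 - t ^ 2).rpow_const
    fun t => Or.inr (by linarith)

theorem hasDerivAt_one_sub_sq_rpow (k : ℕ) {t : ℝ} (ht : t ∈ Set.Ioo (-1 : ℝ) 1) :
    HasDerivAt (fun t : ℝ => (1 - t ^ 2) ^ (((k : ℝ) - 1) / 2))
      (-((k : ℝ) - 1) * (t * sphereWeight k t)) t := by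
  have h1 : HasDerivAt (fun t : ℝ => 1 - t ^ 2) (-(2 * t)) t := by
    simpa using (hasDerivAt_pow 2 t).const_sub 1
  refine (h1.rpow_const (Or.inl (one_sub_sq_pos ht).ne')).congr_deriv ?_
  rw [sphereWeight, show ((k : ℝ) - 1) / 2 - 1 = ((k : ℝ) - 3) / 2 by ring]
  ring

/-- For `k = 2` the weight is unbounded near the endpoints. However, `t * sphereWeight k t` is, up
to a constant, the derivative of the continuous `(1 - t²)^((k-1)/2)` and keeps its sign on each half
of the interval, so it is integrable; then split the weight `w` as `(1 - t²) w + t (t w)`. -/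
theorem intervalIntegrable_sphereWeight (k : ℕ) [k.AtLeastTwo] :
    IntervalIntegrable (sphereWeight k) volume (-1) 1 := by
  have hk : (2 : ℝ) ≤ k := by exact_mod_cast Nat.AtLeastTwo.prop (n := k)
  have hk' : (0 : ℝ) < k - 1 := by linarith
  have hpos : IntervalIntegrable (fun t => ((k : ℝ) - 1) * (t * sphereWeight k t)) volume 0 1 := by
    refine intervalIntegral.intervalIntegrable_deriv_of_nonneg
      (g := fun t => -(1 - t ^ 2) ^ (((k : ℝ) - 1) / 2))
      (continuous_one_sub_sq_rpow k).neg.continuousOn (fun t ht => ?_) (fun t ht => ?_)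
    all_goals simp only [zero_le_one, inf_of_le_left, sup_of_le_right] at ht
    · exact (hasDerivAt_one_sub_sq_rpow k ⟨by linarith [ht.1], ht.2⟩).neg.congr_deriv (by ring)
    · have := sphereWeight_nonneg k (t := t) ⟨by linarith [ht.1], ht.2.le⟩
      have := ht.1.le
      positivity
  have hneg : IntervalIntegrable (fun t => -((k : ℝ) - 1) * (t * sphereWeight k t))
      volume (-1) 0 := by
    refine intervalIntegral.intervalIntegrable_deriv_of_nonneg
      (g := fun t => (1 - t ^ 2) ^ (((k : ℝ) - 1) / 2))
      (continuous_one_sub_sq_rpow k).continuousOn (fun t ht => ?_) (fun t ht => ?_)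
    all_goals
      rw [min_eq_left (by norm_num), max_eq_right (by norm_num)] at ht
    · exact hasDerivAt_one_sub_sq_rpow k ⟨ht.1, by linarith [ht.2]⟩
    · have h1 := sphereWeight_nonneg k (t := t) ⟨ht.1.le, by linarith [ht.2]⟩
      have h2 : 0 ≤ -t := by linarith [ht.2]
      have : -((k : ℝ) - 1) * (t * sphereWeight k t) = (k - 1) * (-t * sphereWeight k t) := by ring
      rw [this]
      positivity
  have htw : IntervalIntegrable (fun t => t * sphereWeight k t) volume (-1) 1 := by
    refine IntervalIntegrable.trans (b := 0) ?_ ?_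
    · refine (hneg.const_mul (-((k : ℝ) - 1))⁻¹).congr fun t _ => ?_
      have : -((k : ℝ) - 1) ≠ 0 := by linarith
      field_simp
    · refine (hpos.const_mul ((k : ℝ) - 1)⁻¹).congr fun t _ => ?_
      field_simp
  have h1 : IntervalIntegrable (fun t => t * (t * sphereWeight k t)) volume (-1) 1 :=
    htw.continuousOn_mul continuousOn_id
  have h2 := ((continuous_one_sub_sq_rpow k).intervalIntegrable (μ := volume) (-1) 1).add h1
  refine h2.congr fun t ht => ?_
  rw [Set.uIoc_of_le (by norm_num)] at ht
  have := sphereWeight_mul_one_sub_sq k (t := t) ⟨ht.1.le, ht.2⟩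
  rw [← this]
  ring

theorem intervalIntegrable_mul_sphereWeight (k : ℕ) [k.AtLeastTwo] {g : ℝ → ℝ}
    (hg : Continuous g) : IntervalIntegrable (fun t => g t * sphereWeight k t) volume (-1) 1 :=
  (intervalIntegrable_sphereWeight k).continuousOn_mul hg.continuousOn

/-- Integration by parts against `(1 - t²)^((k-1)/2)`, which vanishes at both ends. It is the exact
counterpart of `integral_sphere_deriv_mul`. -/
theorem integral_sphereWeight_deriv_mul (k : ℕ) [k.AtLeastTwo] {f f' : ℝ → ℝ}
    (hf : ∀ t, HasDerivAt f (f' t) t) (hf' : Continuous f') :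
    ∫ t in (-1 : ℝ)..1, f' t * (1 - t ^ 2) * sphereWeight k t
      = (k - 1) * ∫ t in (-1 : ℝ)..1, f t * t * sphereWeight k t := by
  have hk : (2 : ℝ) ≤ k := by exact_mod_cast Nat.AtLeastTwo.prop (n := k)
  have hfc : Continuous f := continuous_iff_continuousAt.2 fun t => (hf t).continuousAt
  have h1 := intervalIntegrable_mul_sphereWeight k
    (by fun_prop : Continuous fun t => f' t * (1 - t ^ 2))
  have h2 := intervalIntegrable_mul_sphereWeight k (by fun_prop : Continuous fun t => f t * t)
  have h := intervalIntegral.integral_eq_sub_of_hasDerivAt_of_le (a := -1) (b := 1)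
    (f := fun t => f t * (1 - t ^ 2) ^ (((k : ℝ) - 1) / 2))
    (f' := fun t => f' t * (1 - t ^ 2) * sphereWeight k t
      - (k - 1) * (f t * t * sphereWeight k t)) (by norm_num)
    (hfc.mul (continuous_one_sub_sq_rpow k)).continuousOn
    (fun t ht => ((hf t).mul (hasDerivAt_one_sub_sq_rpow k ht)).congr_deriv (by
      rw [← sphereWeight_mul_one_sub_sq k ⟨ht.1.le, ht.2.le⟩]; ring))
    (h1.sub (h2.const_mul _))
  rw [intervalIntegral.integral_sub h1 (h2.const_mul _),
    intervalIntegral.integral_const_mul] at h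
  have hz : (0 : ℝ) ^ (((k : ℝ) - 1) / 2) = 0 := Real.zero_rpow (by linarith)
  norm_num [hz] at h
  linarith

theorem integral_mul_sphereWeight_pos (k : ℕ) [k.AtLeastTwo] {g : ℝ → ℝ}
    (hg : Continuous g) (hpos : ∀ t, 0 < g t) :
    0 < ∫ t in (-1 : ℝ)..1, g t * sphereWeight k t :=
  intervalIntegral.intervalIntegral_pos_of_pos_on (intervalIntegrable_mul_sphereWeight k hg)
    (fun t ht => mul_pos (hpos t) (Real.rpow_pos_of_pos (one_sub_sq_pos ht) _)) (by norm_num)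

theorem abs_inner_sphere_le {k : ℕ} (x : Sphere k) (u : EuclideanSpace ℝ (Fin k)) :
    |inner ℝ (x : EuclideanSpace ℝ (Fin k)) u| ≤ ‖u‖ := by
  simpa using abs_real_inner_le_norm (x : EuclideanSpace ℝ (Fin k)) u

theorem inner_sphere_mem_Icc {k : ℕ} (x : Sphere k) {θ : EuclideanSpace ℝ (Fin k)}
    (hθ : ‖θ‖ = 1) : inner ℝ (x : EuclideanSpace ℝ (Fin k)) θ ∈ Set.Icc (-1 : ℝ) 1 :=
  abs_le.1 ((abs_inner_sphere_le x θ).trans_eq hθ)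

/-- Taking `f = t^(n+1)` in the two integration by parts formulas gives the same recursion `(n + k)
m_{n+2} = (n + 1) m_n` for both moment sequences; `f = 1` gives `m_1 = 0`. -/
theorem integral_sphere_pow {k : ℕ} [k.AtLeastTwo] {θ : EuclideanSpace ℝ (Fin k)}
    (hθ : ‖θ‖ = 1) (n : ℕ) :
    (∫ t in (-1 : ℝ)..1, sphereWeight k t) *
        ∫ x : Sphere k, inner ℝ (x : EuclideanSpace ℝ (Fin k)) θ ^ n ∂surfaceMeasure k
      = (surfaceMeasure k).real Set.univ * ∫ t in (-1 : ℝ)..1, t ^ n * sphereWeight k t := by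
  have hk : (2 : ℝ) ≤ k := by exact_mod_cast Nat.AtLeastTwo.prop (n := k)
  induction n using Nat.strong_induction_on with
  | _ n ih =>
    match n with
    | 0 => simp [mul_comm]
    | 1 =>
      have h1 := integral_sphere_deriv_mul hθ (f := fun _ => 1) (f' := fun _ => 0)
        (fun t => hasDerivAt_const t 1) continuous_const
      have h2 := integral_sphereWeight_deriv_mul k (f := fun _ => 1) (f' := fun _ => 0)
        (fun t => hasDerivAt_const t 1) continuous_const
      have hk1 : (k : ℝ) - 1 ≠ 0 := by linarith
      simp only [zero_mul, one_mul, integral_zero, intervalIntegral.integral_zero, zero_eq_mul,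
        hk1, false_or] at h1 h2
      simp only [pow_one, h1, h2, mul_zero]
    | n + 2 =>
      have hd (t : ℝ) : HasDerivAt (fun t : ℝ => t ^ (n + 1)) (((n : ℝ) + 1) * t ^ n) t := by
        simpa using hasDerivAt_pow (n + 1) t
      have h1 := integral_sphere_deriv_mul hθ hd (by fun_prop)
      have h2 := integral_sphereWeight_deriv_mul k hd (by fun_prop)
      have e1 : ∀ t : ℝ, ((n : ℝ) + 1) * t ^ n * (1 - t ^ 2)
          = (n + 1) * t ^ n - (n + 1) * t ^ (n + 2) := by intro t; ring
      have e2 : ∀ t : ℝ, t ^ (n + 1) * t = t ^ (n + 2) := by intro t; ring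
      simp only [e1, e2, sub_mul] at h1 h2
      rw [integral_sub (integrable_of_continuous (by fun_prop))
        (integrable_of_continuous (by fun_prop)), integral_const_mul, integral_const_mul] at h1
      rw [intervalIntegral.integral_sub
        (intervalIntegrable_mul_sphereWeight k (by fun_prop))
        (intervalIntegrable_mul_sphereWeight k (by fun_prop))] at h2
      simp only [mul_assoc] at h2
      rw [intervalIntegral.integral_const_mul, intervalIntegral.integral_const_mul] at h2
      have h0 := ih n (by omega)
      have hpos : (0 : ℝ) < n + k := by positivity
      have h0' := congrArg (((n : ℝ) + 1) * ·) h0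
      refine mul_left_cancel₀ hpos.ne' ?_
      linear_combination h0' - (∫ t in (-1 : ℝ)..1, sphereWeight k t) * h1
        + (surfaceMeasure k).real Set.univ * h2

theorem integral_sphere_polynomial {k : ℕ} [k.AtLeastTwo] {θ : EuclideanSpace ℝ (Fin k)}
    (hθ : ‖θ‖ = 1) (p : Polynomial ℝ) :
    (∫ t in (-1 : ℝ)..1, sphereWeight k t) *
        ∫ x : Sphere k, p.eval (inner ℝ (x : EuclideanSpace ℝ (Fin k)) θ) ∂surfaceMeasure k
      = (surfaceMeasure k).real Set.univ *
        ∫ t in (-1 : ℝ)..1, p.eval t * sphereWeight k t := by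
  induction p using Polynomial.induction_on' with
  | add p q hp hq =>
    simp only [Polynomial.eval_add, add_mul]
    rw [integral_add (integrable_of_continuous (by fun_prop))
      (integrable_of_continuous (by fun_prop)), intervalIntegral.integral_add
        (intervalIntegrable_mul_sphereWeight k (by fun_prop))
        (intervalIntegrable_mul_sphereWeight k (by fun_prop)), mul_add, mul_add, hp, hq]
  | monomial n a =>
    simp only [Polynomial.eval_monomial, mul_assoc]
    rw [integral_const_mul, intervalIntegral.integral_const_mul]
    linear_combination a * integral_sphere_pow hθ n

/-- The projection of the surface measure on a direction has density proportional to
`(1 - t²)^{(k-3)/2}`. -/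
theorem integral_sphere_inner {k : ℕ} [k.AtLeastTwo] {θ : EuclideanSpace ℝ (Fin k)}
    (hθ : ‖θ‖ = 1) {g : ℝ → ℝ} (hg : Continuous g) :
    (∫ t in (-1 : ℝ)..1, sphereWeight k t) *
        ∫ x : Sphere k, g (inner ℝ (x : EuclideanSpace ℝ (Fin k)) θ) ∂surfaceMeasure k
      = (surfaceMeasure k).real Set.univ * ∫ t in (-1 : ℝ)..1, g t * sphereWeight k t := by
  set W := ∫ t in (-1 : ℝ)..1, sphereWeight k t with hW
  set S := (surfaceMeasure k).real Set.univ with hS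
  have hW0 : 0 ≤ W := intervalIntegral.integral_nonneg (by norm_num)
    fun t ht => sphereWeight_nonneg k ht
  have hS0 : 0 ≤ S := measureReal_nonneg
  rw [← sub_eq_zero]
  refine abs_nonpos_iff.1 (le_of_forall_pos_le_add fun ε hε => ?_)
  have hden : 0 < 2 * (W * S) + 1 := by positivity
  -- Replacing `g` by `p` costs at most `δ * W * S` on each side, hence the factor 2; the `+ 1`
  -- keeps the denominator positive without knowing that `W` and `S` are.
  obtain ⟨p, hp⟩ := exists_polynomial_near_of_continuousOn (-1) 1 g hg.continuousOn
    (ε / (2 * (W * S) + 1)) (by positivity)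
  set δ := ε / (2 * (W * S) + 1) with hδ
  have hpc : Continuous fun t => p.eval t := p.continuous
  have h1 : |∫ x : Sphere k, (p.eval (inner ℝ (x : EuclideanSpace ℝ (Fin k)) θ)
      - g (inner ℝ (x : EuclideanSpace ℝ (Fin k)) θ)) ∂surfaceMeasure k| ≤ δ * S := by
    have hb : ∀ᵐ x : Sphere k ∂surfaceMeasure k, ‖p.eval (inner ℝ (x : EuclideanSpace ℝ (Fin k)) θ)
        - g (inner ℝ (x : EuclideanSpace ℝ (Fin k)) θ)‖ ≤ δ :=
      Eventually.of_forall fun x => (hp _ (inner_sphere_mem_Icc x hθ)).le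
    exact norm_integral_le_of_norm_le_const hb
  have h2 : |∫ t in (-1 : ℝ)..1, (p.eval t - g t) * sphereWeight k t| ≤ δ * W := by
    rw [hW, ← intervalIntegral.integral_const_mul, ← Real.norm_eq_abs]
    refine intervalIntegral.norm_integral_le_of_norm_le (by norm_num)
      (Eventually.of_forall fun t ht => ?_) ((intervalIntegrable_sphereWeight k).const_mul δ)
    have ht' : t ∈ Set.Icc (-1 : ℝ) 1 := ⟨ht.1.le, ht.2⟩
    rw [Real.norm_eq_abs, abs_mul, abs_of_nonneg (sphereWeight_nonneg k ht')]
    exact mul_le_mul_of_nonneg_right (hp t ht').le (sphereWeight_nonneg k ht')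
  rw [integral_sub (integrable_of_continuous (by fun_prop))
    (integrable_of_continuous (by fun_prop))] at h1
  simp only [sub_mul] at h2
  rw [intervalIntegral.integral_sub (intervalIntegrable_mul_sphereWeight k hpc)
    (intervalIntegrable_mul_sphereWeight k hg)] at h2
  have h3 := integral_sphere_polynomial hθ p
  have hδε : 2 * (W * S) * δ ≤ ε := by
    rw [hδ, mul_div_assoc', div_le_iff₀ hden]
    nlinarith
  obtain ⟨a1, a2⟩ := abs_le.1 h1
  obtain ⟨b1, b2⟩ := abs_le.1 h2
  rw [abs_le]
  constructor <;> nlinarith [mul_le_mul_of_nonneg_left a1 hW0, mul_le_mul_of_nonneg_left a2 hW0,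
    mul_le_mul_of_nonneg_left b1 hS0, mul_le_mul_of_nonneg_left b2 hS0]

/-! ### Normalizing constant, its derivatives, and FvML moments -/

/-- The logarithm of the normalizing constant of the projected FvML density. -/
def logPartition (k : ℕ) (κ : ℝ) : ℝ := Real.log (∫ t in (-1 : ℝ)..1, projWeight k κ t)

theorem surfaceMeasure_real_univ_pos (k : ℕ) [k.AtLeastTwo] :
    0 < (surfaceMeasure k).real Set.univ := by
  have : Nonempty (Fin k) := ⟨⟨0, by have := Nat.AtLeastTwo.prop (n := k); omega⟩⟩
  have : NeZero (surfaceMeasure k) := ⟨by unfold surfaceMeasure; simp⟩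
  exact measureReal_univ_pos

theorem integral_sphereWeight_pos (k : ℕ) [k.AtLeastTwo] :
    0 < ∫ t in (-1 : ℝ)..1, sphereWeight k t := by
  simpa using integral_mul_sphereWeight_pos k (g := fun _ => 1) continuous_const (by simp)

theorem integral_projWeight_pos (k : ℕ) [k.AtLeastTwo] (κ : ℝ) :
    0 < ∫ t in (-1 : ℝ)..1, projWeight k κ t :=
  integral_mul_sphereWeight_pos k (by fun_prop) (fun t => Real.exp_pos (κ * t))

theorem integral_sphere_inner' {k : ℕ} [k.AtLeastTwo] {θ : EuclideanSpace ℝ (Fin k)}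
    (hθ : ‖θ‖ = 1) {g : ℝ → ℝ} (hg : Continuous g) :
    ∫ x : Sphere k, g (inner ℝ (x : EuclideanSpace ℝ (Fin k)) θ) ∂surfaceMeasure k
      = (surfaceMeasure k).real Set.univ / (∫ t in (-1 : ℝ)..1, sphereWeight k t) *
        ∫ t in (-1 : ℝ)..1, g t * sphereWeight k t := by
  have := (integral_sphereWeight_pos k).ne'
  field_simp
  linarith [integral_sphere_inner hθ hg]

theorem integral_sphere_exp_inner {k : ℕ} [k.AtLeastTwo] {θ : EuclideanSpace ℝ (Fin k)}
    (hθ : ‖θ‖ = 1) (κ : ℝ) :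
    ∫ x : Sphere k, Real.exp (κ * inner ℝ (x : EuclideanSpace ℝ (Fin k)) θ) ∂surfaceMeasure k
      = (surfaceMeasure k).real Set.univ / (∫ t in (-1 : ℝ)..1, sphereWeight k t) *
        ∫ t in (-1 : ℝ)..1, projWeight k κ t :=
  integral_sphere_inner' hθ (by fun_prop : Continuous fun t => Real.exp (κ * t))

theorem integral_fvml {k : ℕ} (κ : ℝ) (θ : EuclideanSpace ℝ (Fin k)) (G : Sphere k → ℝ) :
    ∫ x, G x ∂fvml k κ θ
      = (∫ x : Sphere k, Real.exp (κ * inner ℝ (x : EuclideanSpace ℝ (Fin k)) θ) * G x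
          ∂surfaceMeasure k) /
        ∫ x : Sphere k, Real.exp (κ * inner ℝ (x : EuclideanSpace ℝ (Fin k)) θ)
          ∂surfaceMeasure k := by
  rw [fvml, integral_tilted, ← integral_div]
  congr 1
  ext x
  rw [smul_eq_mul]
  ring

theorem integral_fvml_inner {k : ℕ} [k.AtLeastTwo] {θ : EuclideanSpace ℝ (Fin k)}
    (hθ : ‖θ‖ = 1) (κ : ℝ) {g : ℝ → ℝ} (hg : Continuous g) :
    ∫ x : Sphere k, g (inner ℝ (x : EuclideanSpace ℝ (Fin k)) θ) ∂fvml k κ θ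
      = (∫ t in (-1 : ℝ)..1, g t * projWeight k κ t) / ∫ t in (-1 : ℝ)..1, projWeight k κ t := by
  have h1 := (surfaceMeasure_real_univ_pos k).ne'
  have h2 := (integral_sphereWeight_pos k).ne'
  have h3 := (integral_projWeight_pos k κ).ne'
  rw [integral_fvml, integral_sphere_exp_inner hθ,
    integral_sphere_inner' hθ (g := fun t => Real.exp (κ * t) * g t) (by fun_prop),
    mul_div_mul_left _ _ (div_ne_zero h1 h2)]
  congr 2
  ext t
  rw [projWeight_eq]
  ring

theorem log_integral_sphere_exp_sub {k : ℕ} [k.AtLeastTwo] {θ θ' : EuclideanSpace ℝ (Fin k)}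
    (hθ : ‖θ‖ = 1) (hθ' : ‖θ'‖ = 1) (κ κ' : ℝ) :
    Real.log (∫ x : Sphere k, Real.exp (κ' * inner ℝ (x : EuclideanSpace ℝ (Fin k)) θ')
          ∂surfaceMeasure k)
      - Real.log (∫ x : Sphere k, Real.exp (κ * inner ℝ (x : EuclideanSpace ℝ (Fin k)) θ)
          ∂surfaceMeasure k)
      = logPartition k κ' - logPartition k κ := by
  have h := div_ne_zero (surfaceMeasure_real_univ_pos k).ne' (integral_sphereWeight_pos k).ne'
  rw [integral_sphere_exp_inner hθ, integral_sphere_exp_inner hθ',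
    Real.log_mul h (integral_projWeight_pos k κ).ne',
    Real.log_mul h (integral_projWeight_pos k κ').ne', logPartition, logPartition]
  ring

/-- Differentiation under the integral sign is carried out on the sphere, where the coordinate is a
bounded variable with exponential moments of all orders, and is transported to `[-1, 1]` by
`integral_sphere_inner'`. -/
theorem hasDerivAt_integral_pow_mul_projWeight (k : ℕ) [k.AtLeastTwo] (n : ℕ) (κ : ℝ) :
    HasDerivAt (fun κ => ∫ t in (-1 : ℝ)..1, t ^ n * projWeight k κ t)
      (∫ t in (-1 : ℝ)..1, t ^ (n + 1) * projWeight k κ t) κ := by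
  have hk : 0 < k := by have := Nat.AtLeastTwo.prop (n := k); omega
  let θ : EuclideanSpace ℝ (Fin k) := EuclideanSpace.single ⟨0, hk⟩ 1
  have hθ : ‖θ‖ = 1 := by simp [θ]
  let X : Sphere k → ℝ := fun x => inner ℝ (x : EuclideanSpace ℝ (Fin k)) θ
  have hX : Continuous X := by fun_prop
  have huniv : integrableExpSet X (surfaceMeasure k) = Set.univ :=
    Set.eq_univ_of_forall fun t => integrable_of_continuous (by fun_prop)
  have h := hasDerivAt_integral_pow_mul_exp_real (X := X) (μ := surfaceMeasure k) (t := κ)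
    (by simp [huniv]) n
  have hc := (div_pos (surfaceMeasure_real_univ_pos k) (integral_sphereWeight_pos k)).ne'
  set c := (surfaceMeasure k).real Set.univ / ∫ t in (-1 : ℝ)..1, sphereWeight k t with hcdef
  have e (n : ℕ) (κ : ℝ) : ∫ t in (-1 : ℝ)..1, t ^ n * projWeight k κ t
      = c⁻¹ * ∫ x, X x ^ n * Real.exp (κ * X x) ∂surfaceMeasure k := by
    have := integral_sphere_inner' hθ (g := fun t => t ^ n * Real.exp (κ * t)) (by fun_prop)
    simp only [X]
    rw [this, ← hcdef, inv_mul_cancel_left₀ hc]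
    simp only [projWeight_eq, mul_assoc]
  simp only [e]
  exact h.const_mul c⁻¹

theorem hasDerivAt_logPartition (k : ℕ) [k.AtLeastTwo] (κ : ℝ) :
    HasDerivAt (logPartition k) (meanA k κ) κ := by
  have h := hasDerivAt_integral_pow_mul_projWeight k 0 κ
  simp only [pow_zero, one_mul, zero_add, pow_one] at h
  exact h.log (integral_projWeight_pos k κ).ne'

theorem intervalIntegrable_mul_projWeight (k : ℕ) [k.AtLeastTwo] (κ : ℝ) {g : ℝ → ℝ}
    (hg : Continuous g) : IntervalIntegrable (fun t => g t * projWeight k κ t) volume (-1) 1 := by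
  simp only [projWeight_eq, ← mul_assoc]
  exact intervalIntegrable_mul_sphereWeight k (by fun_prop)

/-- Integration by parts with `f = exp (κ t)`. It links `fisherJ` to `meanA` and gives the closed
form of the second moment behind `fisherI`. -/
theorem mul_integral_one_sub_sq_mul_projWeight (k : ℕ) [k.AtLeastTwo] (κ : ℝ) :
    κ * ∫ t in (-1 : ℝ)..1, (1 - t ^ 2) * projWeight k κ t
      = (k - 1) * ∫ t in (-1 : ℝ)..1, t * projWeight k κ t := by
  have h := integral_sphereWeight_deriv_mul k (f := fun t => Real.exp (κ * t))
    (f' := fun t => Real.exp (κ * t) * κ)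
    (fun t => (by simpa using ((hasDerivAt_id t).const_mul κ).exp)) (by fun_prop)
  have e1 : ∀ t, Real.exp (κ * t) * κ * (1 - t ^ 2) * sphereWeight k t
      = κ * ((1 - t ^ 2) * projWeight k κ t) := fun t => by rw [projWeight_eq]; ring
  have e2 : ∀ t, Real.exp (κ * t) * t * sphereWeight k t
      = t * projWeight k κ t := fun t => by rw [projWeight_eq]; ring
  simpa only [e1, e2, intervalIntegral.integral_const_mul] using h

theorem fisherJ_eq (k : ℕ) (κ : ℝ) :
    fisherJ k κ = (∫ t in (-1 : ℝ)..1, (1 - t ^ 2) * projWeight k κ t) /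
      ∫ t in (-1 : ℝ)..1, projWeight k κ t := by
  rw [fisherJ, ← intervalIntegral.integral_div]
  simp only [projDensity, mul_div_assoc]

theorem mul_fisherJ (k : ℕ) [k.AtLeastTwo] (κ : ℝ) : κ * fisherJ k κ = (k - 1) * meanA k κ := by
  rw [fisherJ_eq, meanA, ← mul_div_assoc, mul_integral_one_sub_sq_mul_projWeight, mul_div_assoc]

theorem integral_sq_mul_projWeight_div (k : ℕ) [k.AtLeastTwo] {κ : ℝ} (hκ : κ ≠ 0) :
    (∫ t in (-1 : ℝ)..1, t ^ 2 * projWeight k κ t) / ∫ t in (-1 : ℝ)..1, projWeight k κ t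
      = fisherI k κ + meanA k κ ^ 2 := by
  have h := mul_integral_one_sub_sq_mul_projWeight k κ
  have h1 := intervalIntegrable_mul_projWeight k κ (g := fun _ => 1) continuous_const
  have h2 := intervalIntegrable_mul_projWeight k κ (g := fun t => t ^ 2) (by fun_prop)
  simp only [one_mul] at h1
  simp only [sub_mul, one_mul] at h
  rw [intervalIntegral.integral_sub h1 h2] at h
  have h0 := (integral_projWeight_pos k κ).ne'
  rw [fisherI, meanA]
  field_simp
  linear_combination (-∫ t in (-1 : ℝ)..1, projWeight k κ t) * h

/-- The quotient rule yields the variance of the projection, which `integral_sq_mul_projWeight_div`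
identifies with `fisherI`. -/
theorem hasDerivAt_meanA (k : ℕ) [k.AtLeastTwo] {κ : ℝ} (hκ : κ ≠ 0) :
    HasDerivAt (meanA k) (fisherI k κ) κ := by
  have h0 := hasDerivAt_integral_pow_mul_projWeight k 0 κ
  have h1 := hasDerivAt_integral_pow_mul_projWeight k 1 κ
  simp only [pow_zero, one_mul, zero_add, pow_one, Nat.reduceAdd] at h0 h1
  have hne := (integral_projWeight_pos k κ).ne'
  refine (h1.div h0 hne).congr_deriv ?_
  rw [← sub_eq_iff_eq_add.2 (integral_sq_mul_projWeight_div k hκ), meanA]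
  field_simp

theorem continuousAt_meanA (k : ℕ) [k.AtLeastTwo] {κ : ℝ} (hκ : κ ≠ 0) :
    ContinuousAt (meanA k) κ := (hasDerivAt_meanA k hκ).continuousAt

theorem continuousAt_fisherI (k : ℕ) [k.AtLeastTwo] {κ : ℝ} (hκ : κ ≠ 0) :
    ContinuousAt (fisherI k) κ := by
  have h := continuousAt_meanA k hκ
  unfold fisherI
  fun_prop (disch := assumption)

theorem integral_fvml_inner_self {k : ℕ} [k.AtLeastTwo] {θ : EuclideanSpace ℝ (Fin k)}
    (hθ : ‖θ‖ = 1) (κ : ℝ) :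
    ∫ x : Sphere k, inner ℝ (x : EuclideanSpace ℝ (Fin k)) θ ∂fvml k κ θ = meanA k κ :=
  integral_fvml_inner hθ κ continuous_id

theorem integral_fvml_sub_meanA_sq {k : ℕ} [k.AtLeastTwo] {θ : EuclideanSpace ℝ (Fin k)}
    (hθ : ‖θ‖ = 1) {κ : ℝ} (hκ : κ ≠ 0) :
    ∫ x : Sphere k, (inner ℝ (x : EuclideanSpace ℝ (Fin k)) θ - meanA k κ) ^ 2 ∂fvml k κ θ
      = fisherI k κ := by
  have h1 := integral_fvml_inner hθ κ (g := fun t => t ^ 2) (by fun_prop)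
  rw [integral_sq_mul_projWeight_div k hκ] at h1
  have e : ∀ t : ℝ, (t - meanA k κ) ^ 2 = t ^ 2 - 2 * meanA k κ * t + meanA k κ ^ 2 :=
    fun t => by ring
  simp only [e]
  rw [integral_add (integrable_of_continuous (by fun_prop))
    (integrable_of_continuous (by fun_prop)), integral_sub (integrable_of_continuous (by fun_prop))
    (integrable_of_continuous (by fun_prop)), integral_const_mul, integral_fvml_inner_self hθ, h1]
  simp
  ring

theorem integral_fvml_odd {k : ℕ} {θ e : EuclideanSpace ℝ (Fin k)} (hθ : ‖θ‖ = 1)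
    (hθe : inner ℝ θ e = 0) (κ : ℝ) (g : ℝ → ℝ) :
    ∫ x : Sphere k, g (inner ℝ (x : EuclideanSpace ℝ (Fin k)) θ) *
      inner ℝ (x : EuclideanSpace ℝ (Fin k)) e ∂fvml k κ θ = 0 := by
  rw [integral_fvml]
  simp only [← mul_assoc]
  rw [integral_sphere_odd hθ hθe (fun t => Real.exp (κ * t) * g t), zero_div]

/-- Apply `integral_sphere_deriv_mul_sq` to `exp (κ t)` and the normalized `e`: tangential second
moments reduce to `meanA`. -/
theorem mul_integral_fvml_inner_sq {k : ℕ} [k.AtLeastTwo] {θ e : EuclideanSpace ℝ (Fin k)}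
    (hθ : ‖θ‖ = 1) (hθe : inner ℝ θ e = 0) (κ : ℝ) :
    κ * ∫ x : Sphere k, inner ℝ (x : EuclideanSpace ℝ (Fin k)) e ^ 2 ∂fvml k κ θ
      = ‖e‖ ^ 2 * meanA k κ := by
  rcases eq_or_ne e 0 with rfl | he
  · simp
  have hn : ‖e‖ ≠ 0 := norm_ne_zero_iff.2 he
  have h := integral_sphere_deriv_mul_sq hθ (e := ‖e‖⁻¹ • e)
    (by rw [norm_smul, norm_inv, norm_norm, inv_mul_cancel₀ hn])
    (by rw [real_inner_smul_right, hθe, mul_zero]) (f := fun t => Real.exp (κ * t))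
    (f' := fun t => Real.exp (κ * t) * κ)
    (fun t => (by simpa using ((hasDerivAt_id t).const_mul κ).exp)) (by fun_prop)
  have e1 : ∀ x : Sphere k, Real.exp (κ * inner ℝ (x : EuclideanSpace ℝ (Fin k)) θ) * κ *
      inner ℝ (x : EuclideanSpace ℝ (Fin k)) (‖e‖⁻¹ • e) ^ 2
      = κ * (‖e‖ ^ 2)⁻¹ * (Real.exp (κ * inner ℝ (x : EuclideanSpace ℝ (Fin k)) θ) *
        inner ℝ (x : EuclideanSpace ℝ (Fin k)) e ^ 2) := fun x => by
    rw [real_inner_smul_right]; ring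
  simp only [e1, integral_const_mul] at h
  rw [← integral_fvml_inner_self hθ κ, integral_fvml, integral_fvml, ← h]
  field_simp

/-! ### The score and its second moment -/

/-- The derivative at `τ = 0` in the direction `(s, u)` of the log-likelihood of one observation. -/
def score {k : ℕ} (κ : ℝ) (θ : EuclideanSpace ℝ (Fin k)) (s : ℝ) (u : EuclideanSpace ℝ (Fin k))
    (x : Sphere k) : ℝ :=
  s * (inner ℝ (x : EuclideanSpace ℝ (Fin k)) θ - meanA k κ)
    + κ * inner ℝ (x : EuclideanSpace ℝ (Fin k)) (u - inner ℝ θ u • θ)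

/-- The quadratic form of the one-sample Fisher information. -/
def fisherForm {k : ℕ} (κ : ℝ) (θ : EuclideanSpace ℝ (Fin k)) (s : ℝ)
    (u : EuclideanSpace ℝ (Fin k)) : ℝ :=
  s ^ 2 * fisherI k κ + κ * meanA k κ * ‖u - inner ℝ θ u • θ‖ ^ 2

theorem inner_sub_inner_smul_self {k : ℕ} {θ : EuclideanSpace ℝ (Fin k)} (hθ : ‖θ‖ = 1)
    (u : EuclideanSpace ℝ (Fin k)) : inner ℝ θ (u - inner ℝ θ u • θ) = 0 := by
  rw [inner_sub_right, real_inner_smul_right, real_inner_self_eq_norm_sq, hθ]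
  ring

theorem norm_sq_sub_inner_smul_self {k : ℕ} {θ : EuclideanSpace ℝ (Fin k)} (hθ : ‖θ‖ = 1)
    (u : EuclideanSpace ℝ (Fin k)) :
    ‖u - inner ℝ θ u • θ‖ ^ 2 = ‖u‖ ^ 2 - inner ℝ θ u ^ 2 := by
  rw [norm_sub_sq_real, norm_smul, hθ, real_inner_smul_right, real_inner_comm, mul_one,
    Real.norm_eq_abs, sq_abs]
  ring

theorem continuous_score {k : ℕ} (κ : ℝ) (θ : EuclideanSpace ℝ (Fin k)) (s : ℝ)
    (u : EuclideanSpace ℝ (Fin k)) : Continuous (score κ θ s u) := by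
  unfold score; fun_prop

theorem integral_fvml_inner_right {k : ℕ} [k.AtLeastTwo] {θ : EuclideanSpace ℝ (Fin k)}
    (hθ : ‖θ‖ = 1) (κ : ℝ) (c : EuclideanSpace ℝ (Fin k)) :
    ∫ x : Sphere k, inner ℝ (x : EuclideanSpace ℝ (Fin k)) c ∂fvml k κ θ
      = meanA k κ * inner ℝ θ c := by
  have h := integral_fvml_odd hθ (inner_sub_inner_smul_self hθ c) κ (fun _ => 1)
  simp only [one_mul, inner_sub_right, real_inner_smul_right] at h
  rw [integral_sub (integrable_of_continuous (by fun_prop))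
    (integrable_of_continuous (by fun_prop)), integral_const_mul,
    integral_fvml_inner_self hθ] at h
  linarith

theorem integral_score {k : ℕ} [k.AtLeastTwo] {θ : EuclideanSpace ℝ (Fin k)} (hθ : ‖θ‖ = 1)
    (κ s : ℝ) (u : EuclideanSpace ℝ (Fin k)) : ∫ x, score κ θ s u x ∂fvml k κ θ = 0 := by
  unfold score
  rw [integral_add (integrable_of_continuous (by fun_prop))
    (integrable_of_continuous (by fun_prop)), integral_const_mul, integral_const_mul,
    integral_sub (integrable_of_continuous (by fun_prop)) (integrable_const _),
    integral_fvml_inner_self hθ, integral_fvml_inner_right hθ, inner_sub_inner_smul_self hθ]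
  simp

/-- The concentration and location parts are uncorrelated because the cross term is odd in the
tangential direction; this is why the information is block diagonal. -/
theorem integral_score_sq {k : ℕ} [k.AtLeastTwo] {θ : EuclideanSpace ℝ (Fin k)} (hθ : ‖θ‖ = 1)
    {κ : ℝ} (hκ : κ ≠ 0) (s : ℝ) (u : EuclideanSpace ℝ (Fin k)) :
    ∫ x, score κ θ s u x ^ 2 ∂fvml k κ θ = fisherForm κ θ s u := by
  set e := u - inner ℝ θ u • θ with he
  have hθe : inner ℝ θ e = 0 := inner_sub_inner_smul_self hθ u
  have h1 := integral_fvml_sub_meanA_sq hθ hκ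
  have h2 := integral_fvml_odd hθ hθe κ (fun t => t - meanA k κ)
  have h3 := mul_integral_fvml_inner_sq hθ hθe κ
  have ex : ∀ x : Sphere k, score κ θ s u x ^ 2
      = (s ^ 2 * (inner ℝ (x : EuclideanSpace ℝ (Fin k)) θ - meanA k κ) ^ 2
        + 2 * s * κ * ((inner ℝ (x : EuclideanSpace ℝ (Fin k)) θ - meanA k κ) *
          inner ℝ (x : EuclideanSpace ℝ (Fin k)) e))
        + κ ^ 2 * inner ℝ (x : EuclideanSpace ℝ (Fin k)) e ^ 2 := fun x => by
    rw [score, ← he]; ring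
  simp only [ex]
  rw [integral_add (integrable_of_continuous (by fun_prop))
    (integrable_of_continuous (by fun_prop)), integral_add (integrable_of_continuous (by fun_prop))
    (integrable_of_continuous (by fun_prop)), integral_const_mul, integral_const_mul,
    integral_const_mul, h1, h2, fisherForm, ← he]
  linear_combination κ * h3

theorem fisherForm_nonneg {k : ℕ} [k.AtLeastTwo] {θ : EuclideanSpace ℝ (Fin k)} (hθ : ‖θ‖ = 1)
    {κ : ℝ} (hκ : κ ≠ 0) (s : ℝ) (u : EuclideanSpace ℝ (Fin k)) : 0 ≤ fisherForm κ θ s u := by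
  rw [← integral_score_sq hθ hκ]
  exact integral_nonneg fun x => sq_nonneg _

/-! ### Likelihood ratios by exponential tilting -/

theorem pi_tilted {ι : Type*} [Fintype ι] {α : ι → Type*} [∀ i, MeasurableSpace (α i)]
    (μ : ∀ i, Measure (α i)) [∀ i, SigmaFinite (μ i)] (f : ∀ i, α i → ℝ) :
    Measure.pi (fun i => (μ i).tilted (f i))
      = (Measure.pi μ).tilted (fun x => ∑ i, f i (x i)) := by
  refine (Measure.pi_eq fun s hs => ?_)
  rw [tilted_apply_eq_ofReal_integral' _ (MeasurableSet.univ_pi hs), Measure.restrict_pi_pi]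
  simp only [Real.exp_sum]
  rw [integral_fintype_prod_eq_prod (fun i (x : α i) => Real.exp (f i x))]
  simp only [← Finset.prod_div_distrib]
  rw [integral_fintype_prod_eq_prod (μ := fun i => (μ i).restrict (s i))
    (fun i (x : α i) => Real.exp (f i x) / ∫ x, Real.exp (f i x) ∂μ i),
    ENNReal.ofReal_prod_of_nonneg fun i _ => integral_nonneg fun x => div_nonneg
      (Real.exp_pos _).le (integral_nonneg fun _ => (Real.exp_pos _).le)]
  exact Finset.prod_congr rfl fun i _ => (tilted_apply_eq_ofReal_integral' _ (hs i)).symm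

theorem fvml_eq_tilted {k : ℕ} (κ κ' : ℝ) (θ θ' : EuclideanSpace ℝ (Fin k)) :
    fvml k κ' θ' = (fvml k κ θ).tilted
      (fun x => inner ℝ (x : EuclideanSpace ℝ (Fin k)) (κ' • θ' - κ • θ)) := by
  rw [fvml, fvml, tilted_tilted (integrable_of_continuous (by fun_prop))]
  congr 1
  ext x
  simp [inner_sub_right, real_inner_smul_right]

/-- The integral is a ratio of two normalizing constants on the sphere, and neither depends on the
location. -/
theorem log_integral_fvml_exp {k : ℕ} [k.AtLeastTwo] {θ θ' : EuclideanSpace ℝ (Fin k)}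
    (hθ : ‖θ‖ = 1) (hθ' : ‖θ'‖ = 1) (κ κ' : ℝ) :
    Real.log (∫ x : Sphere k, Real.exp (inner ℝ (x : EuclideanSpace ℝ (Fin k))
        (κ' • θ' - κ • θ)) ∂fvml k κ θ) = logPartition k κ' - logPartition k κ := by
  have hpos (κ : ℝ) {θ : EuclideanSpace ℝ (Fin k)} (hθ : ‖θ‖ = 1) :
      ∫ x : Sphere k, Real.exp (κ * inner ℝ (x : EuclideanSpace ℝ (Fin k)) θ)
        ∂surfaceMeasure k ≠ 0 := by
    rw [integral_sphere_exp_inner hθ]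
    exact (mul_pos (div_pos (surfaceMeasure_real_univ_pos k) (integral_sphereWeight_pos k))
      (integral_projWeight_pos k κ)).ne'
  rw [integral_fvml, ← log_integral_sphere_exp_sub hθ hθ', ← Real.log_div (hpos κ' hθ')
    (hpos κ hθ)]
  congr 2
  congr 1
  ext x
  rw [← Real.exp_add]
  simp [inner_sub_right, real_inner_smul_right]

theorem integrable_sample_of_continuous {m k : ℕ} [k.AtLeastTwo] {N : Fin m → ℕ} {v : Vec m k}
    {F : Type*} [NormedAddCommGroup F] {g : Sample m k N → F} (hg : Continuous g) :
    Integrable g (sampleLaw N v) :=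
  hg.integrable_of_hasCompactSupport (HasCompactSupport.of_compactSpace _)

theorem integral_sampleLaw_prod {m k : ℕ} [k.AtLeastTwo] {𝕜 : Type*} [RCLike 𝕜] (N : Fin m → ℕ)
    (v : Vec m k) (f : Fin m → Sphere k → 𝕜) :
    ∫ x : Sample m k N, ∏ i, ∏ j, f i (x i j) ∂sampleLaw N v
      = ∏ i, (∫ x, f i x ∂fvml k (conc v i) (loc v i)) ^ N i := by
  rw [sampleLaw, integral_fintype_prod_eq_prod
    (fun i (y : Fin (N i) → Sphere k) => ∏ j, f i (y j))]
  refine Finset.prod_congr rfl fun i _ => ?_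
  rw [integral_fintype_prod_eq_prod (fun _ : Fin (N i) => f i)]
  simp

theorem sampleLaw_eq_tilted {m k : ℕ} [k.AtLeastTwo] (N : Fin m → ℕ) (v v' : Vec m k) :
    sampleLaw N v' = (sampleLaw N v).tilted (fun x => ∑ i, ∑ j,
      inner ℝ (x i j : EuclideanSpace ℝ (Fin k))
        (conc v' i • loc v' i - conc v i • loc v i)) := by
  rw [sampleLaw, sampleLaw, ← pi_tilted _ fun i (y : Fin (N i) → Sphere k) => ∑ j,
      inner ℝ (y j : EuclideanSpace ℝ (Fin k)) (conc v' i • loc v' i - conc v i • loc v i)]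
  congr 1
  ext1 i
  rw [← pi_tilted _ fun _ (y : Sphere k) =>
      inner ℝ (y : EuclideanSpace ℝ (Fin k)) (conc v' i • loc v' i - conc v i • loc v i)]
  congr 1
  ext1 j
  exact fvml_eq_tilted _ _ _ _

/-- The log-density of a tilted measure is the exponent minus the logarithm of its normalizer; by
independence the normalizer is a product of powers. -/
theorem llr_sampleLaw {m k : ℕ} [k.AtLeastTwo] (N : Fin m → ℕ) {v v' : Vec m k}
    (hv : v ∈ paramSet m k) (hv' : v' ∈ paramSet m k) :
    llr (sampleLaw N v') (sampleLaw N v) =ᵐ[sampleLaw N v] fun x => ∑ i,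
      (∑ j, inner ℝ (x i j : EuclideanSpace ℝ (Fin k))
        (conc v' i • loc v' i - conc v i • loc v i)
        - N i * (logPartition k (conc v' i) - logPartition k (conc v i))) := by
  have h := log_rnDeriv_tilted_left_self (μ := sampleLaw N v) (f := fun x => ∑ i, ∑ j,
      inner ℝ (x i j : EuclideanSpace ℝ (Fin k))
        (conc v' i • loc v' i - conc v i • loc v i))
      (integrable_sample_of_continuous (by fun_prop))
  rw [← sampleLaw_eq_tilted] at h
  refine h.trans (Eventually.of_forall fun x => ?_)
  simp only [Real.exp_sum]
  rw [integral_sampleLaw_prod N v fun i (y : Sphere k) => Real.exp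
    (inner ℝ (y : EuclideanSpace ℝ (Fin k)) (conc v' i • loc v' i - conc v i • loc v i)),
    Real.log_prod fun i _ => pow_ne_zero _ (integral_exp_pos
      (integrable_of_continuous (by fun_prop))).ne', Finset.sum_sub_distrib]
  congr 1
  refine Finset.sum_congr rfl fun i _ => ?_
  rw [Real.log_pow, log_integral_fvml_exp (hv i).2 (hv' i).2]

/-! ### Central sequence, information and perturbation in coordinates -/

/-- The root is the norm of the residual, so the sign is rescaled back to the residual itself; where
the residual vanishes, both sides are 0. -/
theorem sqrt_smul_signS {k : ℕ} {θ : EuclideanSpace ℝ (Fin k)} (hθ : ‖θ‖ = 1) (x : Sphere k) :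
    (1 - (inner ℝ (x : EuclideanSpace ℝ (Fin k)) θ) ^ 2) ^ (1 / 2 : ℝ) •
      signS θ (x : EuclideanSpace ℝ (Fin k)) = residual θ x := by
  have hn : ‖residual θ (x : EuclideanSpace ℝ (Fin k))‖ ^ 2
      = 1 - (inner ℝ (x : EuclideanSpace ℝ (Fin k)) θ) ^ 2 := by
    have := norm_sq_sub_inner_smul_self hθ (x : EuclideanSpace ℝ (Fin k))
    rw [real_inner_comm] at this
    simpa [residual] using this
  rw [← hn, ← Real.sqrt_eq_rpow, Real.sqrt_sq (norm_nonneg _), signS, smul_smul]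
  rcases eq_or_ne (residual θ (x : EuclideanSpace ℝ (Fin k))) 0 with h | h
  · rw [h, smul_zero]
  · rw [mul_inv_cancel₀ (norm_ne_zero_iff.2 h), one_smul]

theorem dotProduct_central {m k : ℕ} {N : Fin m → ℕ} {v : Vec m k} (hv : v ∈ paramSet m k)
    (τ : Vec m k) (x : Sample m k N) :
    τ ⬝ᵥ central v x = ∑ i, (N i : ℝ) ^ (-1 / 2 : ℝ) *
      ∑ j, score (conc v i) (loc v i) (conc τ i) (loc τ i) (x i j) := by
  have hinner (i : Fin m) : ∑ a, τ (Sum.inr (a, i)) * centralII (conc v i) (loc v i) (x i) a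
      = (N i : ℝ) ^ (-1 / 2 : ℝ) * ∑ j, conc v i * inner ℝ (x i j : EuclideanSpace ℝ (Fin k))
        (loc τ i - inner ℝ (loc v i) (loc τ i) • loc v i) := by
    have h1 : ∑ a, τ (Sum.inr (a, i)) * centralII (conc v i) (loc v i) (x i) a
        = inner ℝ (centralII (conc v i) (loc v i) (x i)) (loc τ i) := by
      simp [PiLp.inner_apply, loc]
    rw [h1, centralII, real_inner_smul_left, sum_inner, mul_comm (conc v i), mul_assoc,
      Finset.mul_sum]
    congr 1
    refine Finset.sum_congr rfl fun j _ => ?_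
    rw [sqrt_smul_signS (hv i).2, residual, inner_sub_left, inner_sub_right,
      real_inner_smul_left, real_inner_smul_right]
    ring
  rw [dotProduct, Fintype.sum_sum_type, Fintype.sum_prod_type_right, ← Finset.sum_add_distrib]
  refine Finset.sum_congr rfl fun i _ => ?_
  simp only [central, Sum.elim_inl, Sum.elim_inr, hinner, centralI]
  simp only [score, Finset.sum_add_distrib, Finset.mul_sum, mul_add, conc]
  congr 1
  exact Finset.sum_congr rfl fun j _ => by ring

/-- By `mul_fisherJ` the location factor `κ² J / (k - 1)` equals `κ A`, and `I - θθ'` produces the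
squared norm of the tangential part. -/
theorem dotProduct_fisher {m k : ℕ} [k.AtLeastTwo] {v : Vec m k} (hv : v ∈ paramSet m k)
    (τ : Vec m k) :
    τ ⬝ᵥ fisher v *ᵥ τ = ∑ i, fisherForm (conc v i) (loc v i) (conc τ i) (loc τ i) := by
  have hk : (2 : ℝ) ≤ k := by exact_mod_cast Nat.AtLeastTwo.prop (n := k)
  have hk1 : (k : ℝ) - 1 ≠ 0 := by linarith
  have hII (i : Fin m) : ∑ a, τ (Sum.inr (a, i)) *
      ∑ b, fisherII (conc v i) (loc v i) a b * τ (Sum.inr (b, i))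
      = conc v i * meanA k (conc v i) *
        ‖loc τ i - inner ℝ (loc v i) (loc τ i) • loc v i‖ ^ 2 := by
    have hJ : conc v i ^ 2 * fisherJ k (conc v i) / ((k : ℝ) - 1)
        = conc v i * meanA k (conc v i) := by
      rw [div_eq_iff hk1]
      linear_combination conc v i * mul_fisherJ k (conc v i)
    rw [norm_sq_sub_inner_smul_self (hv i).2, ← hJ]
    have h1 : ∀ a, ∑ b, fisherII (conc v i) (loc v i) a b * τ (Sum.inr (b, i))
        = conc v i ^ 2 * fisherJ k (conc v i) / ((k : ℝ) - 1) *
          (τ (Sum.inr (a, i)) - loc v i a * inner ℝ (loc v i) (loc τ i)) := by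
      intro a
      simp only [fisherII, Matrix.smul_apply, Matrix.sub_apply, Matrix.one_apply, vecMulVec_apply,
        smul_eq_mul, mul_assoc, ← Finset.mul_sum, sub_mul, Finset.sum_sub_distrib, ite_mul,
        one_mul, zero_mul, Finset.sum_ite_eq, Finset.mem_univ, if_true]
      congr 3
      simp [PiLp.inner_apply, loc, mul_comm]
    simp only [h1]
    have h2 : ‖loc τ i‖ ^ 2 = ∑ a, τ (Sum.inr (a, i)) * τ (Sum.inr (a, i)) := by
      rw [EuclideanSpace.norm_sq_eq]
      simp [loc, sq]
    have h3 : inner ℝ (loc v i) (loc τ i) ^ 2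
        = ∑ a, τ (Sum.inr (a, i)) * loc v i a * inner ℝ (loc v i) (loc τ i) := by
      rw [← Finset.sum_mul, sq]
      rfl
    rw [h2, h3, ← Finset.sum_sub_distrib, Finset.mul_sum]
    exact Finset.sum_congr rfl fun a _ => by ring
  rw [dotProduct, Fintype.sum_sum_type, Fintype.sum_prod_type_right, ← Finset.sum_add_distrib]
  refine Finset.sum_congr rfl fun i _ => ?_
  rw [fisherForm, ← hII]
  congr 1
  · simp [fisher, Matrix.mulVec, dotProduct, Matrix.diagonal_apply, conc]
    ring
  · refine Finset.sum_congr rfl fun a _ => ?_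
    simp [fisher, Matrix.mulVec, dotProduct, Matrix.blockDiagonal_apply, Fintype.sum_prod_type_right]

theorem posSemidef_fisher {m k : ℕ} [k.AtLeastTwo] {v : Vec m k} (hv : v ∈ paramSet m k) :
    (fisher v).PosSemidef := by
  refine PosSemidef.of_dotProduct_mulVec_nonneg ?_ fun x => ?_
  · have hII (i : Fin m) : (fisherII (conc v i) (loc v i))ᵀ = fisherII (conc v i) (loc v i) := by
      simp [fisherII, Matrix.transpose_sub, Matrix.transpose_vecMulVec]
    rw [Matrix.IsHermitian, Matrix.conjTranspose_eq_transpose_of_trivial, fisher,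
      Matrix.fromBlocks_transpose, Matrix.blockDiagonal_transpose]
    simp [hII]
  · have h := dotProduct_fisher hv (WithLp.toLp 2 x)
    rw [star_trivial, h]
    exact Finset.sum_nonneg fun i _ => fisherForm_nonneg (hv i).2 (hv i).1.ne' _ _

theorem conc_perturb {m k : ℕ} {n : ℕ} (hn : n ≠ 0) (N : Fin m → ℕ) (v τ : Vec m k) (i : Fin m) :
    conc (perturb n N v τ) i = conc v i + (N i : ℝ) ^ (-1 / 2 : ℝ) * conc τ i := by
  have h : (n : ℝ) ^ (-1 / 2 : ℝ) * ((N i : ℝ) / n) ^ (-1 / 2 : ℝ) = (N i : ℝ) ^ (-1 / 2 : ℝ) := by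
    rw [← Real.mul_rpow (by positivity) (by positivity), mul_div_cancel₀ _ (by positivity)]
  simp [perturb, conc, scaleMatrix, Matrix.mulVec, dotProduct, Matrix.diagonal_apply]
  rw [← mul_assoc, h]

theorem loc_perturb {m k : ℕ} {n : ℕ} (hn : n ≠ 0) (N : Fin m → ℕ) (v τ : Vec m k) (i : Fin m) :
    loc (perturb n N v τ) i = loc v i + (N i : ℝ) ^ (-1 / 2 : ℝ) • loc τ i := by
  have h : (n : ℝ) ^ (-1 / 2 : ℝ) * ((N i : ℝ) / n) ^ (-1 / 2 : ℝ) = (N i : ℝ) ^ (-1 / 2 : ℝ) := by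
    rw [← Real.mul_rpow (by positivity) (by positivity), mul_div_cancel₀ _ (by positivity)]
  ext a
  simp [perturb, loc, scaleMatrix, Matrix.mulVec, dotProduct, Matrix.blockDiagonal_apply,
    Fintype.sum_prod_type_right, Matrix.one_apply]
  rw [← mul_assoc, h]

/-! ### Uniform Taylor expansion and convergence in probability -/

/-- A second order Taylor expansion that is uniform in the base point. -/
theorem exists_ball_abs_sub_taylor_two_le {f g h : ℝ → ℝ} {a : ℝ}
    (hf : ∀ᶠ x in 𝓝 a, HasDerivAt f (g x) x) (hg : ∀ᶠ x in 𝓝 a, HasDerivAt g (h x) x)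
    (hh : ContinuousAt h a) {ε : ℝ} (hε : 0 < ε) :
    ∃ δ > 0, ∀ x ∈ Metric.ball a δ, ∀ y ∈ Metric.ball a δ,
      |f y - f x - g x * (y - x) - h a * (y - x) ^ 2 / 2| ≤ ε * (y - x) ^ 2 := by
  obtain ⟨δ, hδ, hball⟩ := Metric.eventually_nhds_iff_ball.1
    (hf.and (hg.and (Metric.continuousAt_iff'.1 hh ε hε)))
  refine ⟨δ, hδ, fun x hx y hy => ?_⟩
  have hsub : ∀ z ∈ segment ℝ x y, z ∈ Metric.ball a δ := fun z hz =>
    (convex_ball a δ).segment_subset hx hy hz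
  have hz_le : ∀ z ∈ segment ℝ x y, |z - x| ≤ |y - x| := fun z hz => by
    rw [segment_eq_uIcc] at hz
    exact Set.abs_sub_left_of_mem_uIcc hz
  have hlin : ∀ z ∈ segment ℝ x y, |g z - g x - h a * (z - x)| ≤ ε * |y - x| := by
    intro z hz
    -- Mean value inequality for `g` minus its linear model; the bound is then fed into a second
    -- application, to `f` minus its quadratic model.
    have := (convex_segment x y).norm_image_sub_le_of_norm_hasDerivWithin_le (𝕜 := ℝ)
      (f := fun z => g z - h a * (z - x)) (f' := fun z => h z - h a) (C := ε)
      (fun w hw => (((hball w (hsub w hw)).2.1).sub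
        (((hasDerivAt_id w).sub_const x).const_mul (h a))).hasDerivWithinAt.congr_deriv (by simp))
      (fun w hw => (hball w (hsub w hw)).2.2.le) (left_mem_segment ℝ x y) hz
    simp only [sub_self, mul_zero, sub_zero, Real.norm_eq_abs] at this
    calc |g z - g x - h a * (z - x)| = |g z - h a * (z - x) - g x| := by congr 1; ring
      _ ≤ ε * |z - x| := this
      _ ≤ ε * |y - x| := mul_le_mul_of_nonneg_left (hz_le z hz) hε.le
  have := (convex_segment x y).norm_image_sub_le_of_norm_hasDerivWithin_le (𝕜 := ℝ)
    (f := fun z => f z - g x * (z - x) - h a * (z - x) ^ 2 / 2)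
    (f' := fun z => g z - g x - h a * (z - x)) (C := ε * |y - x|)
    (fun w hw => (((hball w (hsub w hw)).1.sub
      (((hasDerivAt_id w).sub_const x).const_mul (g x))).sub
      (((((hasDerivAt_id w).sub_const x).pow 2).const_mul (h a)).div_const
        2)).hasDerivWithinAt.congr_deriv (by simp; ring))
    (fun w hw => hlin w hw) (left_mem_segment ℝ x y) (right_mem_segment ℝ x y)
  simp only [sub_self, mul_zero, sub_zero, Real.norm_eq_abs, ne_eq, OfNat.ofNat_ne_zero,
    not_false_eq_true, zero_pow, zero_div] at this
  calc |f y - f x - g x * (y - x) - h a * (y - x) ^ 2 / 2|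
      = |f y - g x * (y - x) - h a * (y - x) ^ 2 / 2 - f x| := by congr 1; ring
    _ ≤ ε * |y - x| * |y - x| := this
    _ = ε * (y - x) ^ 2 := by rw [mul_assoc, ← sq, sq_abs]

theorem IsLittleOP.congr {Ω : ℕ → Type*} [∀ n, MeasurableSpace (Ω n)] {P : ∀ n, Measure (Ω n)}
    {R S : ∀ n, Ω n → ℝ} (h : IsLittleOP P R) (hRS : ∀ᶠ n in atTop, R n =ᵐ[P n] S n) :
    IsLittleOP P S := by
  intro ε hε
  refine (h ε hε).congr' ?_
  filter_upwards [hRS] with n hn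
  refine measure_congr ?_
  filter_upwards [hn] with x hx
  change (ε ≤ |R n x|) = (ε ≤ |S n x|)
  rw [hx]

theorem IsLittleOP.add {Ω : ℕ → Type*} [∀ n, MeasurableSpace (Ω n)] {P : ∀ n, Measure (Ω n)}
    {R S : ∀ n, Ω n → ℝ} (hR : IsLittleOP P R) (hS : IsLittleOP P S) :
    IsLittleOP P (fun n x => R n x + S n x) := by
  intro ε hε
  have h := (hR (ε / 2) (half_pos hε)).add (hS (ε / 2) (half_pos hε))
  rw [add_zero] at h
  refine tendsto_of_tendsto_of_tendsto_of_le_of_le tendsto_const_nhds h (fun _ => zero_le)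
    fun n => (measure_mono fun x hx => ?_).trans (measure_union_le _ _)
  by_contra hcon
  simp only [Set.mem_union, Set.mem_ofPred_eq, not_or, not_le] at hcon hx
  linarith [abs_add_le (R n x) (S n x)]

theorem isLittleOP_of_tendsto {Ω : ℕ → Type*} [∀ n, MeasurableSpace (Ω n)]
    {P : ∀ n, Measure (Ω n)} {d : ℕ → ℝ} (hd : Tendsto d atTop (𝓝 0)) :
    IsLittleOP P (fun n _ => d n) := by
  intro ε hε
  refine tendsto_const_nhds.congr' ?_
  filter_upwards [Metric.tendsto_nhds.1 hd ε hε] with n hn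
  rw [Real.dist_eq, sub_zero] at hn
  simp [not_le.2 hn]

theorem isLittleOP_sum {Ω : ℕ → Type*} [∀ n, MeasurableSpace (Ω n)] {P : ∀ n, Measure (Ω n)}
    {ι : Type*} (s : Finset ι) {R : ι → ∀ n, Ω n → ℝ} (h : ∀ i, IsLittleOP P (R i)) :
    IsLittleOP P (fun n x => ∑ i ∈ s, R i n x) := by
  classical
  induction s using Finset.induction_on with
  | empty => simpa using isLittleOP_of_tendsto (P := P) tendsto_const_nhds
  | insert i s hi ih =>
    simp only [Finset.sum_insert hi]
    exact (h i).add ih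

/-- Chebyshev's inequality for the mean of a continuous function over one of the samples. -/
theorem sampleLaw_abs_mean_sub_ge_le {m k : ℕ} [k.AtLeastTwo] (N : Fin m → ℕ) (v : Vec m k)
    (i : Fin m) (hN : N i ≠ 0) {g : Sphere k → ℝ} (hg : Continuous g) {M : ℝ}
    (hM : ∀ x, |g x| ≤ M) {ε : ℝ} (hε : 0 < ε) :
    sampleLaw N v {x | ε ≤ |(N i : ℝ)⁻¹ * ∑ j, g (x i j) - ∫ y, g y ∂fvml k (conc v i) (loc v i)|}
      ≤ ENNReal.ofReal (M ^ 2 / (N i * ε ^ 2)) := by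
  have hN' : (N i : ℝ) ≠ 0 := by exact_mod_cast hN
  set μ := fvml k (conc v i) (loc v i) with hμ
  let P : Measure (Fin (N i) → Sphere k) := Measure.pi fun _ => μ
  let Y : (Fin (N i) → Sphere k) → ℝ := fun y => (N i : ℝ)⁻¹ * ∑ j, g (y j)
  have hY : Continuous Y := by fun_prop
  have hLp : MemLp Y 2 P := by
    refine MemLp.of_bound hY.aestronglyMeasurable |(N i : ℝ)⁻¹ * ∑ j : Fin (N i), M|
      (Eventually.of_forall fun y => ?_)
    rw [Real.norm_eq_abs, abs_mul, abs_mul]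
    refine mul_le_mul_of_nonneg_left ?_ (abs_nonneg _)
    exact ((Finset.abs_sum_le_sum_abs _ _).trans
      (Finset.sum_le_sum fun j _ => hM _)).trans (le_abs_self _)
  have hgLp : MemLp g 2 μ := MemLp.of_bound hg.aestronglyMeasurable M
    (Eventually.of_forall hM)
  have hvar : Var[Y; P] ≤ M ^ 2 / N i := by
    have h1 : Var[Y; P] = ((N i : ℝ)⁻¹) ^ 2 * (N i * Var[g; μ]) := by
      have h2 := variance_sum_pi (μ := fun _ : Fin (N i) => μ) (X := fun _ => g) fun _ => hgLp
      have h3 : (∑ j, fun y : Fin (N i) → Sphere k => g (y j)) = fun y => ∑ j, g (y j) := by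
        ext y; simp
      rw [variance_const_mul, ← h3, h2]
      simp
    have h4 : Var[g; μ] ≤ M ^ 2 := by
      -- Popoviciu's inequality on `[-M, M]`.
      have := variance_le_sq_of_bounded (μ := μ) (X := g) (a := -M) (b := M)
        (Eventually.of_forall fun x => abs_le.1 (hM x)) hg.aemeasurable
      calc Var[g; μ] ≤ ((M - -M) / 2) ^ 2 := this
        _ = M ^ 2 := by ring
    rw [h1]
    calc ((N i : ℝ)⁻¹) ^ 2 * (N i * Var[g; μ]) = Var[g; μ] / N i := by field_simp
      _ ≤ M ^ 2 / N i := by gcongr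
  have hmean : ∫ y, Y y ∂P = ∫ y, g y ∂μ := by
    rw [integral_const_mul, integral_finsetSum _ fun j _ =>
      (integrable_comp_eval (μ := fun _ : Fin (N i) => μ) (integrable_of_continuous hg))]
    have : ∀ j, ∫ y : Fin (N i) → Sphere k, g (y j) ∂Measure.pi (fun _ => μ)
        = ∫ y, g y ∂μ := fun j =>
      (integral_comp_eval (μ := fun _ : Fin (N i) => μ) hg.aestronglyMeasurable)
    simp only [this, Finset.sum_const, Finset.card_univ, Fintype.card_fin, nsmul_eq_mul]
    field_simp
  have hcheb := meas_ge_le_variance_div_sq hLp hε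
  rw [hmean] at hcheb
  have hmp := measurePreserving_eval
    (fun i => Measure.pi fun _ : Fin (N i) => fvml k (conc v i) (loc v i)) i
  have hms : MeasurableSet {y | ε ≤ |Y y - ∫ y, g y ∂μ|} :=
    (isClosed_le continuous_const (by fun_prop)).measurableSet
  have heq := hmp.measure_preimage hms.nullMeasurableSet
  refine (le_of_eq ?_).trans (hcheb.trans (ENNReal.ofReal_le_ofReal ?_))
  · exact heq
  · rw [← div_div]
    gcongr

/-- The Chebyshev bound depends on the integrand only through its supremum, so both the direction
and the law may vary with `n`. -/
theorem isLittleOP_mean_sub {m k : ℕ} [k.AtLeastTwo] {N : ℕ → Fin m → ℕ} {vn : ℕ → Vec m k}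
    {i : Fin m} (hN : Tendsto (fun n => N n i) atTop atTop) {c : ℕ → EuclideanSpace ℝ (Fin k)}
    {M : ℝ} (hc : ∀ᶠ n in atTop, ‖c n‖ ≤ M) :
    IsLittleOP (fun n => sampleLaw (N n) (vn n)) (fun n x =>
      (N n i : ℝ)⁻¹ * ∑ j, inner ℝ (x i j : EuclideanSpace ℝ (Fin k)) (c n)
        - ∫ y : Sphere k, inner ℝ (y : EuclideanSpace ℝ (Fin k)) (c n)
          ∂fvml k (conc (vn n) i) (loc (vn n) i)) := by
  intro ε hε
  have hlim : Tendsto (fun n => ENNReal.ofReal (M ^ 2 / (N n i * ε ^ 2))) atTop (𝓝 0) := by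
    rw [← ENNReal.ofReal_zero]
    refine ENNReal.tendsto_ofReal (Tendsto.div_atTop tendsto_const_nhds ?_)
    exact (tendsto_natCast_atTop_atTop.comp hN).atTop_mul_const (by positivity)
  refine tendsto_of_tendsto_of_tendsto_of_le_of_le' tendsto_const_nhds hlim
    (Eventually.of_forall fun _ => zero_le) ?_
  filter_upwards [hc, hN.eventually_ne_atTop 0] with n hn hn0
  exact sampleLaw_abs_mean_sub_ge_le (N n) (vn n) i hn0 (by fun_prop)
    (fun x => (abs_inner_sphere_le x (c n)).trans hn) hε

/-- The Taylor error is a small multiple of `(a s)²`, and `M a² = 1` makes `M` times it a small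
multiple of the bounded `s²`. The linear coefficient must stay at `κn`, as it is multiplied by `M
a`; the quadratic one can be frozen at `κ`. -/
theorem tendsto_natCast_mul_logPartition_sub (k : ℕ) [k.AtLeastTwo] {κ : ℝ} (hκ : 0 < κ)
    {κn a s : ℕ → ℝ} {M : ℕ → ℕ} (hκn : Tendsto κn atTop (𝓝 κ)) (ha : Tendsto a atTop (𝓝 0))
    (hMa : ∀ᶠ n in atTop, (M n : ℝ) * a n ^ 2 = 1) {C : ℝ} (hs : ∀ n, |s n| ≤ C) :
    Tendsto (fun n => M n * (logPartition k (κn n + a n * s n) - logPartition k (κn n))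
      - M n * a n * s n * meanA k (κn n) - s n ^ 2 * fisherI k κ / 2) atTop (𝓝 0) := by
  have hC : 0 ≤ C := (abs_nonneg _).trans (hs 0)
  have has : Tendsto (fun n => a n * s n) atTop (𝓝 0) := by
    refine squeeze_zero_norm (a := fun n => |a n| * C) (fun n => ?_) (by simpa using ha.abs.mul_const C)
    rw [Real.norm_eq_abs, abs_mul]
    exact mul_le_mul_of_nonneg_left (hs n) (abs_nonneg _)
  have hκn' : Tendsto (fun n => κn n + a n * s n) atTop (𝓝 κ) := by simpa using hκn.add has
  rw [Metric.tendsto_nhds]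
  intro ε hε
  obtain ⟨δ, hδ, h⟩ := exists_ball_abs_sub_taylor_two_le
    (Eventually.of_forall fun x => hasDerivAt_logPartition k x)
    ((eventually_ne_nhds hκ.ne').mono fun x hx => hasDerivAt_meanA k hx)
    (continuousAt_fisherI k hκ.ne') (ε := ε / (C ^ 2 + 1)) (by positivity)
  filter_upwards [hκn.eventually (Metric.ball_mem_nhds κ hδ),
    hκn'.eventually (Metric.ball_mem_nhds κ hδ), hMa] with n h1 h2 h3
  have h4 := h _ h1 _ h2
  rw [add_sub_cancel_left] at h4
  have hM0 : (0 : ℝ) ≤ M n := Nat.cast_nonneg _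
  have h5 := mul_le_mul_of_nonneg_left h4 hM0
  rw [← abs_of_nonneg hM0, ← abs_mul, abs_of_nonneg hM0] at h5
  have h6 : (M n : ℝ) * (ε / (C ^ 2 + 1) * (a n * s n) ^ 2) = ε / (C ^ 2 + 1) * s n ^ 2 := by
    linear_combination (ε / (C ^ 2 + 1) * s n ^ 2) * h3
  have h7 : s n ^ 2 ≤ C ^ 2 := sq_le_sq.2 ((hs n).trans (le_abs_self C))
  rw [Real.dist_eq, sub_zero]
  calc |M n * (logPartition k (κn n + a n * s n) - logPartition k (κn n))
        - M n * a n * s n * meanA k (κn n) - s n ^ 2 * fisherI k κ / 2|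
      = |(M n : ℝ) * (logPartition k (κn n + a n * s n) - logPartition k (κn n)
          - meanA k (κn n) * (a n * s n) - fisherI k κ * (a n * s n) ^ 2 / 2)| := by
        congr 1
        linear_combination (s n ^ 2 * fisherI k κ / 2) * h3
    _ ≤ ε / (C ^ 2 + 1) * s n ^ 2 := h5.trans_eq h6
    _ ≤ ε / (C ^ 2 + 1) * C ^ 2 := by gcongr
    _ < ε := by
        rw [div_mul_eq_mul_div, div_lt_iff₀ (by positivity)]
        nlinarith

/-! ### The remainder of the log-likelihood ratio -/

/-- The stochastic part of the remainder of the log-likelihood ratio is driven by the mean of the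
sample along this vector. -/
def remainderDirection {k : ℕ} (κ : ℝ) (θ : EuclideanSpace ℝ (Fin k)) (s : ℝ)
    (u : EuclideanSpace ℝ (Fin k)) : EuclideanSpace ℝ (Fin k) :=
  s • u - (κ * ‖u‖ ^ 2 / 2) • θ

/-- Expand the square of the norm: a chord of the sphere is tangent up to a normal component of
order `a`. -/
theorem inner_eq_of_norm_add_smul {k : ℕ} {θ u : EuclideanSpace ℝ (Fin k)} {a : ℝ}
    (ha : a ≠ 0) (hθ : ‖θ‖ = 1) (hθ' : ‖θ + a • u‖ = 1) :
    inner ℝ θ u = -(a * ‖u‖ ^ 2 / 2) := by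
  have h := norm_add_sq_real θ (a • u)
  rw [hθ, hθ', norm_smul, mul_pow, Real.norm_eq_abs, sq_abs, real_inner_smul_right] at h
  refine mul_left_cancel₀ ha ?_
  linear_combination -h / 2

/-- Since `⟪θn, u⟫` and `⟪θ, u⟫` tend to 0, the expectation along the remainder direction
contributes `-κ A ‖u‖² / 2` in the limit and the log-partition terms contribute `-s² fisherI / 2`;
together they cancel half of `fisherForm`. -/
theorem tendsto_remainder (k : ℕ) [k.AtLeastTwo] {κ : ℝ} (hκ : 0 < κ)
    {θ : EuclideanSpace ℝ (Fin k)} {κn a s : ℕ → ℝ} {M : ℕ → ℕ}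
    {θn u : ℕ → EuclideanSpace ℝ (Fin k)} (hκn : Tendsto κn atTop (𝓝 κ))
    (hθn : Tendsto θn atTop (𝓝 θ)) (hθn1 : ∀ n, ‖θn n‖ = 1) (ha : Tendsto a atTop (𝓝 0))
    (hMa : ∀ᶠ n in atTop, (M n : ℝ) * a n ^ 2 = 1) {C : ℝ} (hs : ∀ n, |s n| ≤ C)
    (hu : ∀ n, ‖u n‖ ≤ C) (hθ' : ∀ᶠ n in atTop, ‖θn n + a n • u n‖ = 1) :
    Tendsto (fun n => meanA k (κn n) *
        inner ℝ (θn n) (remainderDirection (κn n) (θn n) (s n) (u n))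
      + M n * a n * s n * meanA k (κn n)
      - M n * (logPartition k (κn n + a n * s n) - logPartition k (κn n))
      + fisherForm κ θ (s n) (u n) / 2) atTop (𝓝 0) := by
  have hC : 0 ≤ C := (abs_nonneg _).trans (hs 0)
  have hθ1 : ‖θ‖ = 1 := tendsto_nhds_unique hθn.norm (by simp [hθn1])
  have hA : Tendsto (fun n => meanA k (κn n)) atTop (𝓝 (meanA k κ)) :=
    (continuousAt_meanA k hκ.ne').tendsto.comp hκn
  have hbdd {f g : ℕ → ℝ} {B : ℝ} (hf : Tendsto f atTop (𝓝 0)) (hg : ∀ n, |g n| ≤ B) :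
      Tendsto (fun n => f n * g n) atTop (𝓝 0) := by
    refine squeeze_zero_norm (a := fun n => |f n| * B) (fun n => ?_)
      (by simpa using hf.abs.mul_const B)
    rw [Real.norm_eq_abs, abs_mul]
    exact mul_le_mul_of_nonneg_left (hg n) (abs_nonneg _)
  have husq : ∀ n, |‖u n‖ ^ 2| ≤ C ^ 2 := fun n => by
    rw [abs_of_nonneg (by positivity)]
    exact pow_le_pow_left₀ (norm_nonneg _) (hu n) 2
  have hin : Tendsto (fun n => inner ℝ (θn n) (u n)) atTop (𝓝 0) := by
    have := (hbdd ha husq).neg.div_const 2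
    simp only [neg_zero, zero_div] at this
    refine this.congr' ?_
    filter_upwards [hMa, hθ'] with n h1 h2
    have han : a n ≠ 0 := by rintro h; simp [h] at h1
    rw [inner_eq_of_norm_add_smul han (hθn1 n) h2]
    ring
  have hin' : Tendsto (fun n => inner ℝ θ (u n)) atTop (𝓝 0) := by
    have h1 : Tendsto (fun n => inner ℝ (θn n - θ) (u n)) atTop (𝓝 0) := by
      refine squeeze_zero_norm (a := fun n => ‖θn n - θ‖ * C) (fun n => ?_) ?_
      · exact (norm_inner_le_norm _ _).trans (mul_le_mul_of_nonneg_left (hu n) (norm_nonneg _))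
      · simpa using (tendsto_iff_norm_sub_tendsto_zero.1 hθn).mul_const C
    have h2 := hin.sub h1
    simpa [inner_sub_left] using h2
  have hK := tendsto_natCast_mul_logPartition_sub k hκ hκn ha hMa hs
  have t1 := hA.mul (hbdd hin hs)
  have t2 := hbdd (f := fun n => (κ * meanA k κ - κn n * meanA k (κn n)) / 2)
    (by simpa using ((hκn.mul hA).const_sub (κ * meanA k κ)).div_const 2) husq
  have t3 := (hin'.pow 2).const_mul (κ * meanA k κ / 2)
  have ht := ((t1.add t2).sub t3).sub hK
  simp only [mul_zero, ne_eq, OfNat.ofNat_ne_zero, not_false_eq_true, zero_pow, add_zero,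
    sub_zero] at ht
  refine ht.congr fun n => ?_
  rw [remainderDirection, inner_sub_right, real_inner_smul_right, real_inner_smul_right,
    real_inner_self_eq_norm_sq, hθn1, fisherForm, norm_sq_sub_inner_smul_self hθ1]
  ring

/-- An exact identity: the normal component of `u` is eliminated by the norm constraint, and the
expectation is subtracted and added back to separate randomness from the deterministic term. -/
theorem log_likelihood_remainder_eq {k M : ℕ} [k.AtLeastTwo] {κ a s q : ℝ}
    {θ u : EuclideanSpace ℝ (Fin k)} (hθ : ‖θ‖ = 1) (hθ' : ‖θ + a • u‖ = 1)
    (hMa : (M : ℝ) * a ^ 2 = 1) (y : Fin M → Sphere k) :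
    ∑ j, inner ℝ (y j : EuclideanSpace ℝ (Fin k)) ((κ + a * s) • (θ + a • u) - κ • θ)
        - M * (logPartition k (κ + a * s) - logPartition k κ)
        - (a * ∑ j, score κ θ s u (y j) - 1 / 2 * q)
      = ((M : ℝ)⁻¹ * ∑ j, inner ℝ (y j : EuclideanSpace ℝ (Fin k)) (remainderDirection κ θ s u)
          - ∫ x : Sphere k, inner ℝ (x : EuclideanSpace ℝ (Fin k)) (remainderDirection κ θ s u)
            ∂fvml k κ θ)
        + (meanA k κ * inner ℝ θ (remainderDirection κ θ s u) + M * a * s * meanA k κ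
          - M * (logPartition k (κ + a * s) - logPartition k κ) + q / 2) := by
  have ha : a ≠ 0 := by rintro rfl; simp at hMa
  have hM : (M : ℝ) ≠ 0 := by rintro h; simp [h] at hMa
  have hin := inner_eq_of_norm_add_smul ha hθ hθ'
  have ha2 : (M : ℝ)⁻¹ = a ^ 2 := by field_simp; linarith
  have hterm : ∀ j, inner ℝ (y j : EuclideanSpace ℝ (Fin k))
        ((κ + a * s) • (θ + a • u) - κ • θ)
      = a * score κ θ s u (y j) + (a ^ 2 * inner ℝ (y j : EuclideanSpace ℝ (Fin k))
        (remainderDirection κ θ s u) + a * s * meanA k κ) := fun j => by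
    simp only [score, remainderDirection, inner_sub_right, inner_add_right,
      real_inner_smul_right, hin]
    ring
  rw [integral_fvml_inner_right hθ, ha2]
  simp only [hterm, Finset.sum_add_distrib, ← Finset.mul_sum, Finset.sum_const, Finset.card_univ,
    Fintype.card_fin, nsmul_eq_mul]
  ring

/-! ### Central limit theorem by characteristic functions -/

theorem norm_pow_sub_pow_le_of_norm_le_one {z w : ℂ} (hz : ‖z‖ ≤ 1) (hw : ‖w‖ ≤ 1) (n : ℕ) :
    ‖z ^ n - w ^ n‖ ≤ n * ‖z - w‖ := by
  induction n with
  | zero => simp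
  | succ n ih =>
    have h : z ^ (n + 1) - w ^ (n + 1) = z * (z ^ n - w ^ n) + (z - w) * w ^ n := by ring
    rw [h]
    refine (norm_add_le _ _).trans ?_
    rw [norm_mul, norm_mul, norm_pow]
    have h1 : ‖z‖ * ‖z ^ n - w ^ n‖ ≤ 1 * (n * ‖z - w‖) :=
      mul_le_mul hz ih (norm_nonneg _) zero_le_one
    have h2 : ‖z - w‖ * ‖w‖ ^ n ≤ ‖z - w‖ * 1 :=
      mul_le_mul_of_nonneg_left (pow_le_one₀ (norm_nonneg _) hw) (norm_nonneg _)
    push_cast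
    linarith

theorem norm_exp_mul_I_sub_le {x : ℝ} (hx : |x| ≤ 1) :
    ‖Complex.exp (x * Complex.I) - (1 + x * Complex.I - ((x ^ 2 / 2 : ℝ) : ℂ))‖ ≤ |x| ^ 3 := by
  have hn : ‖(x : ℂ) * Complex.I‖ = |x| := by simp
  have h := Complex.exp_bound (x := x * Complex.I) (by rwa [hn]) (n := 3) (by norm_num)
  rw [hn] at h
  have hs : ∑ m ∈ Finset.range 3, ((x : ℂ) * Complex.I) ^ m / (m.factorial : ℂ)
      = 1 + x * Complex.I - ((x ^ 2 / 2 : ℝ) : ℂ) := by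
    simp only [Finset.sum_range_succ, Finset.range_zero, Finset.sum_empty, mul_pow,
      Complex.I_sq, Nat.factorial]
    push_cast
    ring
  rw [hs] at h
  refine h.trans (mul_le_of_le_one_right (by positivity) ?_)
  norm_num [Nat.factorial]

/-- A quantitative central limit theorem for characteristic functions of sums of bounded centered
variables. -/
theorem norm_charFun_pow_sub_le {Ω : Type*} [MeasurableSpace Ω] {μ : Measure Ω}
    [IsProbabilityMeasure μ] {g : Ω → ℝ} (hg : Measurable g) {M : ℝ} (hM : ∀ x, |g x| ≤ M)
    (hg0 : ∫ x, g x ∂μ = 0) {N : ℕ} {a : ℝ} (ha : 0 ≤ a) (haM : a * M ≤ 1)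
    (hNa : (N : ℝ) * a ^ 2 = 1) :
    ‖(∫ x, Complex.exp ((a * g x : ℝ) * Complex.I) ∂μ) ^ N
      - Complex.exp (-((∫ x, g x ^ 2 ∂μ) / 2 : ℝ))‖ ≤ 2 * M ^ 3 * a := by
  obtain ⟨x₀⟩ : Nonempty Ω := nonempty_of_isProbabilityMeasure μ
  have hM0 : 0 ≤ M := (abs_nonneg _).trans (hM x₀)
  set V := ∫ x, g x ^ 2 ∂μ with hV
  have hgi : Integrable g μ := Integrable.of_bound hg.aestronglyMeasurable M (Eventually.of_forall hM)
  have hsq : ∀ x, g x ^ 2 ≤ M ^ 2 := fun x => sq_le_sq.2 ((hM x).trans (le_abs_self M))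
  have hg2i : Integrable (fun x => g x ^ 2) μ :=
    Integrable.of_bound (hg.pow_const 2).aestronglyMeasurable (M ^ 2)
      (Eventually.of_forall fun x => by
        rw [Real.norm_eq_abs, abs_of_nonneg (sq_nonneg _)]; exact hsq x)
  have hV0 : 0 ≤ V := integral_nonneg fun x => sq_nonneg _
  have hVM : V ≤ M ^ 2 := by
    have := integral_mono hg2i (integrable_const (M ^ 2)) hsq
    simpa using this
  have hag : ∀ x, |a * g x| ≤ a * M := fun x => by
    rw [abs_mul, abs_of_nonneg ha]
    exact mul_le_mul_of_nonneg_left (hM x) ha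
  have hei : Integrable (fun x => Complex.exp ((a * g x : ℝ) * Complex.I)) μ :=
    Integrable.of_bound (by fun_prop) 1
      (Eventually.of_forall fun x => by rw [Complex.norm_exp_ofReal_mul_I])
  have hφ : ‖∫ x, Complex.exp ((a * g x : ℝ) * Complex.I) ∂μ‖ ≤ 1 := by
    have := norm_integral_le_of_norm_le_const (μ := μ)
      (f := fun x => Complex.exp ((a * g x : ℝ) * Complex.I)) (C := 1)
      (Eventually.of_forall fun x => by rw [Complex.norm_exp_ofReal_mul_I])
    simpa using this
  set φ := ∫ x, Complex.exp ((a * g x : ℝ) * Complex.I) ∂μ with hφdef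
  have hmean : ∫ x, (1 + (a * g x : ℝ) * Complex.I - (((a * g x) ^ 2 / 2 : ℝ) : ℂ)) ∂μ
      = 1 - ((a ^ 2 * V / 2 : ℝ) : ℂ) := by
    have i1 : Integrable (fun x => ((a * g x : ℝ) : ℂ) * Complex.I) μ :=
      ((hgi.const_mul a).ofReal).mul_const _
    have i2 : Integrable (fun x => (((a * g x) ^ 2 / 2 : ℝ) : ℂ)) μ := by
      simp only [mul_pow]
      exact ((hg2i.const_mul (a ^ 2)).div_const 2).ofReal
    have i0 : Integrable (fun x => 1 + ((a * g x : ℝ) : ℂ) * Complex.I) μ :=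
      (integrable_const _).add i1
    rw [integral_sub i0 i2, integral_add (integrable_const _) i1,
      integral_mul_const, integral_complex_ofReal, integral_complex_ofReal, integral_const_mul, hg0]
    simp only [mul_pow]
    rw [integral_div, integral_const_mul]
    simp [hV]
  -- Both the characteristic function `φ` and the Gaussian factor `exp (-a² V / 2)` lie within `(a
  -- M)³` of `1 - a² V / 2`.
  have h1 : ‖φ - (1 - ((a ^ 2 * V / 2 : ℝ) : ℂ))‖ ≤ (a * M) ^ 3 := by
    have i3 : Integrable (fun x => 1 + (a * g x : ℝ) * Complex.I
        - (((a * g x) ^ 2 / 2 : ℝ) : ℂ)) μ := by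
      refine ((integrable_const _).add (((hgi.const_mul a).ofReal).mul_const _)).sub ?_
      simp only [mul_pow]
      exact ((hg2i.const_mul (a ^ 2)).div_const 2).ofReal
    rw [← hmean, hφdef, ← integral_sub hei i3]
    have := norm_integral_le_of_norm_le_const (μ := μ)
      (f := fun x => Complex.exp ((a * g x : ℝ) * Complex.I) - (1 + (a * g x : ℝ) * Complex.I
        - (((a * g x) ^ 2 / 2 : ℝ) : ℂ))) (C := (a * M) ^ 3)
      (Eventually.of_forall fun x => (norm_exp_mul_I_sub_le ((hag x).trans haM)).trans
        (pow_le_pow_left₀ (abs_nonneg _) (hag x) 3))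
    simpa using this
  have ht0 : 0 ≤ a ^ 2 * V / 2 := by positivity
  have htM : a ^ 2 * V / 2 ≤ (a * M) ^ 2 := by
    rw [mul_pow]
    nlinarith [mul_le_mul_of_nonneg_left hVM (sq_nonneg a)]
  have haM0 : 0 ≤ a * M := mul_nonneg ha hM0
  have h2 : ‖Complex.exp (-(a ^ 2 * V / 2 : ℝ)) - (1 - ((a ^ 2 * V / 2 : ℝ) : ℂ))‖
      ≤ (a * M) ^ 3 := by
    have hn : ‖-((a ^ 2 * V / 2 : ℝ) : ℂ)‖ = a ^ 2 * V / 2 := by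
      rw [norm_neg, Complex.norm_real, Real.norm_eq_abs, abs_of_nonneg ht0]
    have := Complex.norm_exp_sub_one_sub_id_le (x := -((a ^ 2 * V / 2 : ℝ) : ℂ))
      (by rw [hn]; nlinarith)
    rw [hn] at this
    calc _ = ‖Complex.exp (-((a ^ 2 * V / 2 : ℝ) : ℂ)) - 1 - -((a ^ 2 * V / 2 : ℝ) : ℂ)‖ := by
          congr 1; ring
      _ ≤ (a ^ 2 * V / 2) ^ 2 := this
      _ ≤ ((a * M) ^ 2) ^ 2 := pow_le_pow_left₀ ht0 htM 2
      _ = (a * M) ^ 3 * (a * M) := by ring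
      _ ≤ (a * M) ^ 3 := mul_le_of_le_one_right (by positivity) haM
  -- As `N a² = 1`, the Gaussian limit is itself an `N`-th power, so the bases can be compared; the
  -- error `N * 2 (a M)³` is `2 M³ a`.
  have h3 : Complex.exp (-(V / 2 : ℝ)) = Complex.exp (-(a ^ 2 * V / 2 : ℝ)) ^ N := by
    rw [← Complex.exp_nat_mul]
    congr 1
    have : V / 2 = N * (a ^ 2 * V / 2) := by linear_combination (-V / 2) * hNa
    rw [this]
    push_cast
    ring
  have h4 : ‖Complex.exp (-(a ^ 2 * V / 2 : ℝ))‖ ≤ 1 := by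
    rw [← Complex.ofReal_neg, ← Complex.ofReal_exp, Complex.norm_real, Real.norm_eq_abs,
      abs_of_pos (Real.exp_pos _), Real.exp_le_one_iff]
    linarith
  rw [h3]
  refine (norm_pow_sub_pow_le_of_norm_le_one hφ h4 N).trans ?_
  have h5 : ‖φ - Complex.exp (-(a ^ 2 * V / 2 : ℝ))‖ ≤ 2 * (a * M) ^ 3 := by
    have := norm_sub_le_norm_sub_add_norm_sub φ (1 - ((a ^ 2 * V / 2 : ℝ) : ℂ))
      (Complex.exp (-(a ^ 2 * V / 2 : ℝ)))
    rw [norm_sub_rev (1 - ((a ^ 2 * V / 2 : ℝ) : ℂ))] at this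
    linarith
  calc (N : ℝ) * ‖φ - Complex.exp (-(a ^ 2 * V / 2 : ℝ))‖ ≤ N * (2 * (a * M) ^ 3) := by gcongr
    _ = 2 * M ^ 3 * a := by linear_combination (2 * a * M ^ 3) * hNa

theorem abs_score_le {k : ℕ} (κ : ℝ) {θ : EuclideanSpace ℝ (Fin k)} (hθ : ‖θ‖ = 1) (s : ℝ)
    (u : EuclideanSpace ℝ (Fin k)) (x : Sphere k) :
    |score κ θ s u x| ≤ |s| * (1 + |meanA k κ|) + |κ| * (2 * ‖u‖) := by
  have h1 := (abs_inner_sphere_le x θ).trans_eq hθ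
  have h2 : ‖u - inner ℝ θ u • θ‖ ≤ 2 * ‖u‖ := by
    refine (norm_sub_le _ _).trans ?_
    have := abs_real_inner_le_norm θ u
    rw [hθ, one_mul] at this
    rw [norm_smul, hθ, mul_one, Real.norm_eq_abs]
    linarith
  refine (abs_add_le _ _).trans ?_
  rw [abs_mul, abs_mul]
  gcongr
  · exact (abs_sub _ _).trans (by gcongr)
  · exact (abs_inner_sphere_le x _).trans h2

theorem tendsto_fisherForm {k : ℕ} [k.AtLeastTwo] {κ : ℝ} (hκ : κ ≠ 0)
    {θ : EuclideanSpace ℝ (Fin k)} {κn : ℕ → ℝ} {θn : ℕ → EuclideanSpace ℝ (Fin k)}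
    (hκn : Tendsto κn atTop (𝓝 κ)) (hθn : Tendsto θn atTop (𝓝 θ)) (s : ℝ)
    (u : EuclideanSpace ℝ (Fin k)) :
    Tendsto (fun n => fisherForm (κn n) (θn n) s u) atTop (𝓝 (fisherForm κ θ s u)) := by
  have hI := (continuousAt_fisherI k hκ).tendsto.comp hκn
  have hA := (continuousAt_meanA k hκ).tendsto.comp hκn
  have hin : Tendsto (fun n => inner ℝ (θn n) u) atTop (𝓝 (inner ℝ θ u)) :=
    hθn.inner tendsto_const_nhds
  exact (hI.const_mul (s ^ 2)).add ((hκn.mul hA).mul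
    (((tendsto_const_nhds.sub (hin.smul hθn)).norm).pow 2))

/-- The score bounds `B n` converge, so the explicit error `2 (B n)³ a n` vanishes along the moving
parameters; the variances converge by continuity. -/
theorem tendsto_integral_exp_score_pow {k : ℕ} [k.AtLeastTwo] {κ : ℝ} (hκ : 0 < κ)
    {θ : EuclideanSpace ℝ (Fin k)} {κn a : ℕ → ℝ} {M : ℕ → ℕ}
    {θn : ℕ → EuclideanSpace ℝ (Fin k)} (hκn : Tendsto κn atTop (𝓝 κ))
    (hθn : Tendsto θn atTop (𝓝 θ)) (hκn0 : ∀ n, 0 < κn n) (hθn1 : ∀ n, ‖θn n‖ = 1)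
    (ha0 : ∀ n, 0 ≤ a n) (ha : Tendsto a atTop (𝓝 0))
    (hMa : ∀ᶠ n in atTop, (M n : ℝ) * a n ^ 2 = 1) (s : ℝ) (u : EuclideanSpace ℝ (Fin k)) :
    Tendsto (fun n => (∫ x, Complex.exp ((a n * score (κn n) (θn n) s u x : ℝ) * Complex.I)
        ∂fvml k (κn n) (θn n)) ^ M n) atTop
      (𝓝 (Complex.exp (-(fisherForm κ θ s u / 2 : ℝ)))) := by
  have hlim : Tendsto (fun n => Complex.exp (-(fisherForm (κn n) (θn n) s u / 2 : ℝ))) atTop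
      (𝓝 (Complex.exp (-(fisherForm κ θ s u / 2 : ℝ)))) :=
    ((Complex.continuous_ofReal.tendsto _).comp
      ((tendsto_fisherForm hκ.ne' hκn hθn s u).div_const 2)).neg.cexp
  let B : ℕ → ℝ := fun n => |s| * (1 + |meanA k (κn n)|) + |κn n| * (2 * ‖u‖)
  have hB : Tendsto B atTop (𝓝 (|s| * (1 + |meanA k κ|) + |κ| * (2 * ‖u‖))) :=
    ((((continuousAt_meanA k hκ.ne').tendsto.comp hκn).abs.const_add 1).const_mul _).add
      (hκn.abs.mul_const _)
  have haB : Tendsto (fun n => a n * B n) atTop (𝓝 0) := by simpa using ha.mul hB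
  have hbound : Tendsto (fun n => 2 * B n ^ 3 * a n) atTop (𝓝 0) := by
    simpa using ((hB.pow 3).const_mul 2).mul ha
  have hdiff := squeeze_zero_norm' (f := fun n =>
    (∫ x, Complex.exp ((a n * score (κn n) (θn n) s u x : ℝ) * Complex.I)
        ∂fvml k (κn n) (θn n)) ^ M n
      - Complex.exp (-(fisherForm (κn n) (θn n) s u / 2 : ℝ))) (by
    filter_upwards [hMa, haB.eventually_le_const zero_lt_one] with n h1 h2
    rw [← integral_score_sq (hθn1 n) (hκn0 n).ne']
    exact norm_charFun_pow_sub_le (continuous_score _ _ _ _).measurable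
      (abs_score_le (κn n) (hθn1 n) s u) (integral_score (hθn1 n) _ _ _) (ha0 n) h2 h1) hbound
  simpa using hdiff.add hlim

theorem measurable_central {m k : ℕ} {N : Fin m → ℕ} {v : Vec m k} (hv : v ∈ paramSet m k) :
    Measurable (central v : Sample m k N → Vec m k) := by
  have hc : Continuous (central v : Sample m k N → Vec m k) := by
    unfold central
    refine (PiLp.continuous_toLp 2 _).comp (continuous_pi fun p => ?_)
    rcases p with i | ⟨a, i⟩
    · simp only [Sum.elim_inl, centralI]
      fun_prop
    -- The residual form avoids the singularity of the spatial sign and makes the whole map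
    -- continuous.
    · simp only [Sum.elim_inr, centralII, sqrt_smul_signS (hv i).2, residual]
      fun_prop
  exact hc.measurable

theorem charFun_map_central {m k : ℕ} [k.AtLeastTwo] (N : Fin m → ℕ) {v : Vec m k}
    (hv : v ∈ paramSet m k) (t : Vec m k) :
    charFun ((sampleLaw N v).map (central v)) t
      = ∏ i, (∫ x, Complex.exp (((N i : ℝ) ^ (-1 / 2 : ℝ) *
          score (conc v i) (loc v i) (conc t i) (loc t i) x : ℝ) * Complex.I)
          ∂fvml k (conc v i) (loc v i)) ^ N i := by
  rw [charFun_apply, integral_map (measurable_central hv).aemeasurable (by fun_prop),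
    ← integral_sampleLaw_prod N v fun i x => Complex.exp (((N i : ℝ) ^ (-1 / 2 : ℝ) *
          score (conc v i) (loc v i) (conc t i) (loc t i) x : ℝ) * Complex.I)]
  congr 1
  ext x
  have h : inner ℝ (central v x) t = t ⬝ᵥ central v x := by
    simp [PiLp.inner_apply, dotProduct]
  rw [h, dotProduct_central hv]
  simp only [← Complex.exp_sum, ← Finset.sum_mul, ← Complex.ofReal_sum, Finset.mul_sum]

/-! ### Coordinate bounds and the proof of the proposition -/

theorem continuous_conc {m k : ℕ} (i : Fin m) : Continuous fun v : Vec m k => conc v i := by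
  unfold conc; fun_prop

theorem continuous_loc {m k : ℕ} (i : Fin m) : Continuous fun v : Vec m k => loc v i := by
  unfold loc; fun_prop

theorem abs_conc_le {m k : ℕ} (v : Vec m k) (i : Fin m) : |conc v i| ≤ ‖v‖ :=
  PiLp.norm_apply_le v _

theorem norm_loc_le {m k : ℕ} (v : Vec m k) (i : Fin m) : ‖loc v i‖ ≤ ‖v‖ := by
  refine (sq_le_sq₀ (norm_nonneg _) (norm_nonneg _)).1 ?_
  rw [EuclideanSpace.norm_sq_eq, EuclideanSpace.norm_sq_eq, Fintype.sum_sum_type,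
    Fintype.sum_prod_type_right]
  have h := Finset.single_le_sum (f := fun i => ∑ a, ‖v (Sum.inr (a, i))‖ ^ 2)
    (fun i _ => Finset.sum_nonneg fun a _ => sq_nonneg _) (Finset.mem_univ i)
  have h2 : 0 ≤ ∑ j, ‖v (Sum.inl j)‖ ^ 2 := Finset.sum_nonneg fun a _ => sq_nonneg _
  refine (le_of_eq ?_).trans (h.trans (le_add_of_nonneg_left h2))
  rfl

end

end FvML

open FvML

theorem mainTheorem5 (m k : ℕ) (hm : 2 ≤ m) [k.AtLeastTwo]
    -- sample sizes with total `n`, and the proportions' limits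
    (N : ℕ → Fin m → ℕ) (hN : ∀ n, ∑ i, N n i = n)
    (r : Fin m → ℝ) (hr : ∀ i, 0 < r i)
    (hNr : ∀ i, Tendsto (fun n : ℕ => (N n i : ℝ) / n) atTop (𝓝 (r i)))
    -- the parameter and a sequence of parameters that is root-`n` close to it
    (v : FvML.Vec m k) (hv : v ∈ FvML.paramSet m k)
    (vn : ℕ → FvML.Vec m k) (hvn : ∀ n, vn n ∈ FvML.paramSet m k)
    (hvnO : (fun n => vn n - v) =O[atTop] fun n : ℕ => (n : ℝ) ^ (-1 / 2 : ℝ))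
    -- a bounded sequence of perturbations that stay in the parameter set
    (τ : ℕ → FvML.Vec m k) (hτ : ∃ C : ℝ, ∀ n, ‖τ n‖ ≤ C)
    (hτmem : ∀ n, FvML.perturb n (N n) (vn n) (τ n) ∈ FvML.paramSet m k) :
    FvML.IsLittleOP (fun n => FvML.sampleLaw (N n) (vn n))
      (fun n x =>
        llr (FvML.sampleLaw (N n) (FvML.perturb n (N n) (vn n) (τ n)))
            (FvML.sampleLaw (N n) (vn n)) x
          - (τ n ⬝ᵥ FvML.central (vn n) x
              - 1 / 2 * (τ n ⬝ᵥ FvML.fisher v *ᵥ τ n))) ∧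
    (FvML.fisher v).PosSemidef ∧
    TendstoInDistribution
      (fun n (x : FvML.Sample m k (N n)) => FvML.central (vn n) x) atTop
      (id : FvML.Vec m k → FvML.Vec m k)
      (fun n => FvML.sampleLaw (N n) (vn n))
      (multivariateGaussian 0 (FvML.fisher v)) := by
  obtain ⟨C, hC⟩ := hτ
  have hneg : (-1 / 2 : ℝ) = -(1 / 2) := by norm_num
  have hvlim : Tendsto vn atTop (𝓝 v) := by
    have h0 : Tendsto (fun n : ℕ => (n : ℝ) ^ (-1 / 2 : ℝ)) atTop (𝓝 0) := by
      rw [hneg]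
      exact (tendsto_rpow_neg_atTop (by norm_num)).comp tendsto_natCast_atTop_atTop
    exact tendsto_sub_nhds_zero_iff.1 (hvnO.trans_tendsto h0)
  have hκ (i : Fin m) : Tendsto (fun n => conc (vn n) i) atTop (𝓝 (conc v i)) :=
    ((continuous_conc i).tendsto v).comp hvlim
  have hθ (i : Fin m) : Tendsto (fun n => loc (vn n) i) atTop (𝓝 (loc v i)) :=
    ((continuous_loc i).tendsto v).comp hvlim
  have hNtop (i : Fin m) : Tendsto (fun n => N n i) atTop atTop := by
    rw [← tendsto_natCast_atTop_iff (R := ℝ)]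
    refine ((hNr i).pos_mul_atTop (hr i) tendsto_natCast_atTop_atTop).congr' ?_
    filter_upwards [eventually_ne_atTop 0] with n hn
    field_simp
  have ha (i : Fin m) : Tendsto (fun n => (N n i : ℝ) ^ (-1 / 2 : ℝ)) atTop (𝓝 0) := by
    rw [hneg]
    exact (tendsto_rpow_neg_atTop (by norm_num)).comp (tendsto_natCast_atTop_atTop.comp (hNtop i))
  have hMa (i : Fin m) : ∀ᶠ n in atTop, (N n i : ℝ) * ((N n i : ℝ) ^ (-1 / 2 : ℝ)) ^ 2 = 1 := by
    filter_upwards [(hNtop i).eventually_ne_atTop 0] with n hn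
    have hpos : (0 : ℝ) < N n i := by positivity
    rw [← Real.rpow_natCast, ← Real.rpow_mul hpos.le]
    norm_num [Real.rpow_neg_one, hpos.ne']
  have hθ' (i : Fin m) : ∀ᶠ n in atTop,
      ‖loc (vn n) i + (N n i : ℝ) ^ (-1 / 2 : ℝ) • loc (τ n) i‖ = 1 := by
    filter_upwards [eventually_ne_atTop 0] with n hn
    rw [← loc_perturb hn]
    exact (hτmem n i).2
  have hPSD := posSemidef_fisher hv
  refine ⟨?_, hPSD, ?_⟩
  -- Per sample: empirical fluctuation plus deterministic limit. The constant `M` bounds the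
  -- remainder direction once the moving concentration is below `conc v i + 1`.
  · have hrem (i : Fin m) := (isLittleOP_mean_sub (vn := vn) (hNtop i)
        (c := fun n => remainderDirection (conc (vn n) i) (loc (vn n) i) (conc (τ n) i)
          (loc (τ n) i)) (M := C * C + (conc v i + 1) * C ^ 2 / 2) (by
        filter_upwards [(hκ i).eventually_le_const (lt_add_one _)] with n hn
        have h0 := (hvn n i).1
        have h3 := (hv i).1
        have h1 := (abs_conc_le (τ n) i).trans (hC n)
        have h2 := (norm_loc_le (τ n) i).trans (hC n)
        have hC0 : 0 ≤ C := (abs_nonneg _).trans h1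
        refine (norm_sub_le _ _).trans ?_
        rw [norm_smul, norm_smul, (hvn n i).2, mul_one, Real.norm_eq_abs, Real.norm_eq_abs,
          abs_of_nonneg (a := conc (vn n) i * ‖loc (τ n) i‖ ^ 2 / 2) (by positivity)]
        gcongr)).add (isLittleOP_of_tendsto (tendsto_remainder k (hv i).1 (hκ i) (hθ i)
          (fun n => (hvn n i).2) (ha i) (hMa i) (fun n => (abs_conc_le (τ n) i).trans (hC n))
          (fun n => (norm_loc_le (τ n) i).trans (hC n)) (hθ' i)))
    refine (isLittleOP_sum Finset.univ hrem).congr ?_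
    filter_upwards [eventually_ne_atTop 0, eventually_all.2 hMa, eventually_all.2 hθ']
      with n hn h1 h2
    filter_upwards [llr_sampleLaw (N n) (hvn n) (hτmem n)] with x hx
    rw [hx, dotProduct_central (hvn n), dotProduct_fisher hv, Finset.mul_sum,
      ← Finset.sum_sub_distrib, ← Finset.sum_sub_distrib]
    refine Finset.sum_congr rfl fun i _ => ?_
    rw [conc_perturb hn, loc_perturb hn]
    exact (log_likelihood_remainder_eq (hvn n i).2 (h2 i) (h1 i) (x i)).symm
  -- Lévy's continuity theorem. It needs no density for the limit, which matters because the
  -- information annihilates each direction `θ_i`.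
  · refine ⟨fun n => (measurable_central (hvn n)).aemeasurable, aemeasurable_id,
      ProbabilityMeasure.tendsto_of_tendsto_charFun fun t => ?_⟩
    simp only [ProbabilityMeasure.coe_mk, Measure.map_id, charFun_multivariateGaussian hPSD]
    have hprod := tendsto_finsetProd Finset.univ fun (i : Fin m) _ =>
      tendsto_integral_exp_score_pow (hv i).1 (hκ i) (hθ i) (fun n => (hvn n i).1)
        (fun n => (hvn n i).2) (fun n => by positivity) (ha i) (hMa i) (conc t i) (loc t i)
    simp only [← charFun_map_central _ (hvn _)] at hprod
    convert hprod using 2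
    rw [← Complex.exp_sum, dotProduct_fisher hv]
    congr 1
    push_cast
    simp [Finset.sum_div]
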